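/- **Theorem (Gluing Theorem).** Let $G$ be an infinite, connected, locally finite, recurrent (simple, undirected) graph with vertex set $v(G)$ and graph distance $d$. Let $(X_n)_{n\ge 0}$ be simple random walk on $G$, with law $\mathbb P_x$ and expectation $\mathbb E_x$ when $X_0=x$. For $A\subset v(G)$ let $T_A=\inf\{n\ge 0: X_n\in A\}$ and $T_A^+=\inf\{n\ge 1: X_n\in A\}$. For finite non-empty $A\subset v(G)$ put $$g_A(x,y)=\frac{1}{\deg(y)}\,\mathbb E_x\Big[\sum_{n=0}^{T_A-1}\mathbf 1_{\{X_n=y\}}\Big],\qquad a_A(x,y)=g_A(y,y)-g_A(x,y).$$ A sequence $(A_n)$ of finite non-empty sets of vertices *goes to infinity* if $\min_{v\in A_n} d(v,o)\to\infty$ for every (equivalently, some) vertex $o$. For disjoint finite non-empty sets $A,B$ let $\mathcal R_{\mathrm{eff}}(B\leftrightarrow A)$ be the effective resistance between $B$ and $A$ in $G$ with unit conductances, i.e. $$\mathcal R_{\mathrm{eff}}(B\leftrightarrow A)^{-1}=\sum_{b\in B}\deg(b)\,\mathbb P_b(T_A<T_B^+).$$ For $f:v(G)\to\mathbb R$ let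 $\Delta f(x)=\sum_{y\sim x}(f(y)-f(x))$. Suppose that the potential kernel of $G$ is well defined: there is a function $a:v(G)\times v(G)\to\mathbb R$ such that $\lim_{n\to\infty}a_{A_n}(x,y)=a(x,y)$ for all $x,y\in v(G)$ and every sequence $(A_n)$ going to infinity. Let $B\subset v(G)$ be finite and non-empty, and suppose that $v(G)\setminus B$ induces a connected subgraph of $G$. Then: 1. For every $w\in v(G)$ the limit $$q_B(w)=\lim_{n\to\infty}\mathcal R_{\mathrm{eff}}(B\leftrightarrow A_n)\,\mathbb P_w(T_{A_n}<T_B)$$ exists along every sequence $(A_n)$ going to infinity and does not depend on the sequence. 2. For every $x\in B$ and every $w\in v(G)$, $$q_B(w)=a(w,x)-\mathbb E_w\big[a(X_{T_B},x)\big];$$ in particular the right-hand side does not depend on the choice of $x\in B$, and $q_B=0$ on $B$. 3. For every $w\in B$ the harmonic measure from infinity $\mathrm{hm}_B(w)=\lim_{z\to\infty}\mathbb P_z(X_{T_B}=w)$ exists, where $z\to\infty$ means that the distance of $z$ to a fixed vertex tends to infinity, and $$(\Delta q_B)(w)=\mathrm{hm}_B(w).$$ -/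

import Mathlib

open MeasureTheory ProbabilityTheory Filter Topology
open scoped ENNReal

namespace GluingTheorem

noncomputable section

/-- The law of one step of simple random walk from `x`: uniform on the neighbours of `x`
(and, by convention, no move if `x` is isolated). -/
def step {V : Type*} (G : SimpleGraph V) [G.LocallyFinite] (x : V) : PMF V :=
  open Classical in
  if h : (G.neighborFinset x).Nonempty then PMF.uniformOfFinset (G.neighborFinset x) h
  else PMF.pure x

/-- The one-step transition kernel of simple random walk. -/
def stepKernel {V : Type*} [MeasurableSpace V] [DiscreteMeasurableSpace V]
    (G : SimpleGraph V) [G.LocallyFinite] : Kernel V V where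
  toFun x := (step G x).toMeasure
  measurable' := Measurable.of_discrete

instance {V : Type*} [MeasurableSpace V] [DiscreteMeasurableSpace V]
    (G : SimpleGraph V) [G.LocallyFinite] : IsMarkovKernel (stepKernel G) :=
  ⟨fun x => inferInstanceAs (IsProbabilityMeasure (step G x).toMeasure)⟩

/-- The transition kernel from the path up to time `n` to the position at time `n + 1`:
it depends only on the position at time `n`. -/
def pathKernel {V : Type*} [MeasurableSpace V] [DiscreteMeasurableSpace V]
    (G : SimpleGraph V) [G.LocallyFinite] (n : ℕ) :
    Kernel ((i : Finset.Iic n) → (fun _ : ℕ => V) i) ((fun _ : ℕ => V) (n + 1)) :=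
  (stepKernel G).comap (fun h => h ⟨n, Finset.mem_Iic.2 le_rfl⟩) (measurable_pi_apply _)

instance {V : Type*} [MeasurableSpace V] [DiscreteMeasurableSpace V]
    (G : SimpleGraph V) [G.LocallyFinite] (n : ℕ) : IsMarkovKernel (pathKernel G n) :=
  inferInstanceAs (IsMarkovKernel ((stepKernel G).comap _ _))

/-- `ℙ_x`: the law, on the space `ℕ → V` of trajectories, of simple random walk on `G`
started at `x`. -/
def walk {V : Type*} [MeasurableSpace V] [DiscreteMeasurableSpace V]
    (G : SimpleGraph V) [G.LocallyFinite] (x : V) : Measure (ℕ → V) :=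
  Kernel.traj (X := fun _ => V) (pathKernel G) 0 (fun _ => x)

instance {V : Type*} [MeasurableSpace V] [DiscreteMeasurableSpace V]
    (G : SimpleGraph V) [G.LocallyFinite] (x : V) : IsProbabilityMeasure (walk G x) := by
  unfold walk
  infer_instance

/-- `G` is recurrent: from every vertex, the walk almost surely returns to its starting point. -/
def IsRecurrent {V : Type*} [MeasurableSpace V] [DiscreteMeasurableSpace V]
    (G : SimpleGraph V) [G.LocallyFinite] : Prop :=
  ∀ x, ∀ᵐ X ∂(walk G x), ∃ n, 1 ≤ n ∧ X n = x

/-- The hitting time `T_A = inf {n ≥ 0 : X_n ∈ A}` (`⊤` if `A` is never hit). -/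
def hitTime {V : Type*} (A : Set V) (X : ℕ → V) : ℕ∞ :=
  ⨅ n ∈ {n : ℕ | X n ∈ A}, (n : ℕ∞)

/-- The first return time `T_A⁺ = inf {n ≥ 1 : X_n ∈ A}` (`⊤` if there is no return). -/
def returnTime {V : Type*} (A : Set V) (X : ℕ → V) : ℕ∞ :=
  ⨅ n ∈ {n : ℕ | 1 ≤ n ∧ X n ∈ A}, (n : ℕ∞)

/-- The hitting point `X_{T_A}` (only meaningful when `T_A < ∞`). -/
def hitPoint {V : Type*} (A : Set V) (X : ℕ → V) : V :=
  X (hitTime A X).toNat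

/-- The Green function `Gr_A(x, y) = 𝔼_x [∑_{n < T_A} 1{X_n = y}]`. -/
def green {V : Type*} [MeasurableSpace V] [DiscreteMeasurableSpace V]
    (G : SimpleGraph V) [G.LocallyFinite] (A : Set V) (x y : V) : ℝ≥0∞ :=
  ∫⁻ X, ∑' n : ℕ, {n : ℕ | (n : ℕ∞) < hitTime A X ∧ X n = y}.indicator 1 n ∂(walk G x)

/-- The normalised Green function `g_A(x, y) = Gr_A(x, y) / deg y`. It is finite when `G` is
connected and recurrent and `A` is non-empty. -/
def greenNorm {V : Type*} [MeasurableSpace V] [DiscreteMeasurableSpace V]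
    (G : SimpleGraph V) [G.LocallyFinite] (A : Set V) (x y : V) : ℝ :=
  (green G A x y).toReal / G.degree y

/-- The truncated potential kernel `a_A(x, y) = g_A(y, y) - g_A(x, y)`. -/
def truncKernel {V : Type*} [MeasurableSpace V] [DiscreteMeasurableSpace V]
    (G : SimpleGraph V) [G.LocallyFinite] (A : Set V) (x y : V) : ℝ :=
  greenNorm G A y y - greenNorm G A x y

/-- A sequence of finite non-empty sets of vertices goes to infinity: `d(A_n, o) → ∞` for every
vertex `o`, where `d(A_n, o)` is the minimal distance of a vertex of `A_n` to `o`. -/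
def GoesToInfinity {V : Type*} (G : SimpleGraph V) (A : ℕ → Finset V) : Prop :=
  (∀ n, (A n).Nonempty) ∧ ∀ (o : V) (r : ℕ), ∀ᶠ n in atTop, ∀ v ∈ A n, r ≤ G.dist o v

/-- `a` is the potential kernel of `G`: `a_{A_n}(x, y) → a(x, y)` for all `x, y` and all
sequences of finite sets going to infinity, with a limit independent of the sequence. -/
def IsPotentialKernel {V : Type*} [MeasurableSpace V] [DiscreteMeasurableSpace V]
    (G : SimpleGraph V) [G.LocallyFinite] (a : V → V → ℝ) : Prop :=
  ∀ A : ℕ → Finset V, GoesToInfinity G A →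
    ∀ x y, Tendsto (fun n => truncKernel G (A n : Set V) x y) atTop (𝓝 (a x y))

/-- The effective resistance between disjoint non-empty finite sets `B` and `A` in a recurrent
graph: `1 / R_eff(B ↔ A) = ∑_{b ∈ B} deg b * ℙ_b(T_A < T_B⁺)`. The right-hand side is
`deg(B) * ℙ_B(T_A < T_B⁺)` on the graph in which `B` is glued to one vertex with the
self-loops removed, and so is the effective conductance between the two glued sets. -/
def effRes {V : Type*} [MeasurableSpace V] [DiscreteMeasurableSpace V]
    (G : SimpleGraph V) [G.LocallyFinite] (B A : Finset V) : ℝ :=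
  (∑ b ∈ B, (G.degree b : ℝ) *
    (walk G b).real {X | hitTime (A : Set V) X < returnTime (B : Set V) X})⁻¹

/-- The graph Laplacian `Δ f (x) = ∑_{y ∼ x} (f y - f x)` (all conductances are one). -/
def laplacian {V : Type*} (G : SimpleGraph V) [G.LocallyFinite] (f : V → ℝ) (x : V) : ℝ :=
  ∑ y ∈ G.neighborFinset x, (f y - f x)

end

end GluingTheorem

/-!
Write `h_A(w) = ℙ_w(T_A < T_B)`, `H(w, b) = ℙ_w(X_{T_B} = b)` and `S_A = R_eff(B ↔ A)⁻¹`, which is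
the flux `∑_{b ∈ B} Δ h_A(b)` out of `B`. Fix `x ∈ B` and put
`q(w) = a(w, x) - ∑_{b ∈ B} a(b, x) H(w, b)` (`hitPotential`).

The function `a_A(·, x) - ∑_b a_A(b, x) H(·, b)` vanishes on `B` and is harmonic off `A ∪ B`, and
on `A` it is `g_A(x, x)` up to a bounded error. By the maximum principle (`nonpos_of_subharmonic`)
it is `g_A(x, x) h_A` up to a multiple of `h_A` that stays bounded, and `h_A → 0` when `A` goes to
infinity because the walk hits `B` almost surely. So `g_A(x, x) h_A(w) → q(w)` for every `w`
(`tendsto_greenNorm_mul_hitProb`). Summing the Laplacian over `B` gives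
`g_A(x, x) S_A → ∑_{b ∈ B} Δ q(b)`, and the latter is `1`: the potential kernel satisfies
`Δ a(·, x) = 1_x`, while each `H(·, b)` has total flux zero out of `B` by reversibility
(`sum_laplacian_hitPotential`). The quotient of the two limits is the limit of
`R_eff(B ↔ A) h_A(w)`, and being a limit that does not involve `x` it does not depend on `x`.

For the harmonic measure from infinity, reversibility for `A = {z}` gives
`H(z, w) S_z = Δ h_z(w)` for `w ∈ B` (`harmMeasure_eq`), that is, `H(z, w)` is the Laplacian at `w`
of `R_eff(B ↔ z) h_z`, which converges to `Δ q(w)`.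

Both uses of reversibility are instances of Green's identity for bounded functions that are harmonic
off a finite set `C` (`sum_mul_laplacian_comm`). There is no boundary term at infinity: such a
function is the sum over `n` of `Qⁿ r`, where `Q` is the transition operator of the walk killed on
`C`, which is self-adjoint for the degree measure, and `r` comes from the values on `C`. Probability
enters only through the Markov property at time one (`walk_map_shift`), which turns every quantity
of the theorem into a solution of a one-step equation, and through the almost sure hitting of every
vertex (`walk_never_hit_eq_zero`).
-/

namespace GluingTheorem

variable {V : Type*}

/-! ### The Markov property at time one -/

/-- The time shift on trajectories. -/
def shift (X : ℕ → V) : ℕ → V := fun n => X (n + 1)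

/-- The trajectories that agree with `c` up to time `n`. -/
def cyl (n : ℕ) (c : ℕ → V) : Set (ℕ → V) := {X | ∀ i ≤ n, X i = c i}

lemma isPiSystem_cyl : IsPiSystem {s : Set (ℕ → V) | ∃ n c, s = cyl n c} := by
  rintro _ ⟨n, c, rfl⟩ _ ⟨m, d, rfl⟩ ⟨Y, hY1, hY2⟩
  refine ⟨max n m, Y, ?_⟩
  ext X
  simp only [cyl, Set.mem_inter_iff, Set.mem_ofPred_eq] at *
  constructor
  · rintro ⟨h1, h2⟩ i hi
    rcases le_max_iff.1 hi with h | h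
    · rw [h1 i h, hY1 i h]
    · rw [h2 i h, hY2 i h]
  · intro h
    exact ⟨fun i hi => (h i (le_max_of_le_left hi)).trans (hY1 i hi),
      fun i hi => (h i (le_max_of_le_right hi)).trans (hY2 i hi)⟩

section Markov

variable [MeasurableSpace V]

lemma measurable_shift : Measurable (shift : (ℕ → V) → ℕ → V) :=
  measurable_pi_lambda _ fun n => measurable_pi_apply (n + 1)

variable [DiscreteMeasurableSpace V]

lemma measurableSet_cyl (n : ℕ) (c : ℕ → V) : MeasurableSet (cyl n c) := by
  have : cyl n c = ⋂ i ∈ Set.Iic n, (fun X : ℕ → V => X i) ⁻¹' {c i} := by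
    ext X; simp [cyl]
  rw [this]
  exact MeasurableSet.biInter (Set.to_countable _) fun i _ =>
    measurable_pi_apply i (MeasurableSet.of_discrete)

variable (G : SimpleGraph V) [G.LocallyFinite]

lemma step_toMeasure_singleton {x : V} (hx : 0 < G.degree x) (v : V) :
    (step G x).toMeasure {v} = (G.neighborSet x).indicator (fun _ => (G.degree x : ℝ≥0∞)⁻¹) v := by
  classical
  have h : (G.neighborFinset x).Nonempty := by
    rw [← Finset.card_pos]; exact hx
  rw [PMF.toMeasure_apply_singleton _ _ MeasurableSet.of_discrete]
  simp only [step, h, dif_pos, PMF.uniformOfFinset_apply, SimpleGraph.mem_neighborFinset,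
    SimpleGraph.card_neighborFinset_eq_degree, Set.indicator, SimpleGraph.mem_neighborSet]

variable [Countable V]

lemma walk_cyl_zero (x : V) (c : ℕ → V) :
    walk G x (cyl 0 c) = ({x} : Set V).indicator 1 (c 0) := by
  have h := Kernel.traj_map_frestrictLe_apply (X := fun _ => V) (κ := pathKernel G) 0 0
    (fun _ => x)
  rw [Kernel.partialTraj_self, Kernel.id_apply] at h
  have h2 := congrArg (fun μ => μ {f | f ⟨0, Finset.mem_Iic.2 le_rfl⟩ = c 0}) h
  have hm : MeasurableSet {f : (i : Finset.Iic 0) → (fun _ : ℕ => V) i |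
      f ⟨0, Finset.mem_Iic.2 le_rfl⟩ = c 0} := by
    measurability
  rw [Measure.map_apply (by fun_prop) hm, Measure.dirac_apply' _ hm] at h2
  have e : cyl 0 c = Preorder.frestrictLe 0 ⁻¹' {f : (i : Finset.Iic 0) → (fun _ : ℕ => V) i |
      f ⟨0, Finset.mem_Iic.2 le_rfl⟩ = c 0} := by
    ext X; simp [cyl]
  rw [e, walk, h2]
  by_cases hx : x = c 0
  · simp [hx]
  · simp [Set.indicator, hx, Ne.symm hx]

lemma walk_cyl_succ (x : V) (n : ℕ) (c : ℕ → V) :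
    walk G x (cyl (n + 1) c) = walk G x (cyl n c) * (step G (c n)).toMeasure {c (n + 1)} := by
  have h := Kernel.partialTraj_compProd_eq_map_traj (X := fun _ => V) (κ := pathKernel G)
    (Nat.zero_le n) (x₀ := fun _ => x)
  set p : (i : Finset.Iic n) → (fun _ : ℕ => V) i := fun i => c i with hp
  have h2 := congrArg (fun μ => μ ({p} ×ˢ {c (n + 1)})) h
  simp only at h2
  rw [Measure.map_apply (by fun_prop) (by measurability),
    Measure.compProd_apply_prod (by measurability) (by measurability),
    lintegral_singleton, ← Kernel.traj_map_frestrictLe_apply,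
    Measure.map_apply (by fun_prop) (by measurability), mul_comm] at h2
  have e1 : cyl (n + 1) c =
      (fun X : ℕ → V => (Preorder.frestrictLe (π := fun _ => V) n X, X (n + 1))) ⁻¹'
      ({p} ×ˢ {c (n + 1)}) := by
    ext X
    simp only [cyl, Set.mem_ofPred_eq, Set.mem_preimage, Set.mem_prod, Set.mem_singleton_iff,
      funext_iff, hp]
    constructor
    · exact fun H => ⟨fun i => H i (by have := Finset.mem_Iic.1 i.2; omega), H _ le_rfl⟩
    · rintro ⟨H, H'⟩ i hi
      rcases hi.lt_or_eq with hi | rfl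
      · exact H ⟨i, Finset.mem_Iic.2 (by omega)⟩
      · exact H'
  have e2 : cyl n c = Preorder.frestrictLe (π := fun _ => V) n ⁻¹' {p} := by
    ext X
    simp only [cyl, Set.mem_ofPred_eq, Set.mem_preimage, Set.mem_singleton_iff, funext_iff, hp]
    constructor
    · exact fun H => fun i => H i (Finset.mem_Iic.1 i.2)
    · exact fun H i hi => H ⟨i, Finset.mem_Iic.2 hi⟩
  rw [e1, e2, walk, ← h2]
  rfl

lemma ae_walk_zero (x : V) : ∀ᵐ X ∂walk G x, X 0 = x := by
  have h := walk_cyl_zero G x (fun _ => x)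
  simp only [Set.indicator, Set.mem_singleton_iff, if_true, Pi.one_apply] at h
  have : {X : ℕ → V | X 0 = x} = cyl 0 (fun _ => x) := by ext; simp [cyl]
  have hm : MeasurableSet {X : ℕ → V | X 0 = x} := this ▸ measurableSet_cyl _ _
  rw [← this] at h
  exact (mem_ae_iff_prob_eq_one hm).2 h

lemma generateFrom_cyl :
    (MeasurableSpace.pi : MeasurableSpace (ℕ → V)) =
      MeasurableSpace.generateFrom {s : Set (ℕ → V) | ∃ n c, s = cyl n c} := by
  apply le_antisymm
  · refine iSup_le fun i => ?_
    rw [MeasurableSpace.comap_le_iff_le_map]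
    intro s _
    change MeasurableSet[MeasurableSpace.generateFrom _] ((fun X : ℕ → V => X i) ⁻¹' s)
    rcases isEmpty_or_nonempty V with hV | ⟨⟨v₀⟩⟩
    · have : (fun X : ℕ → V => X i) ⁻¹' s = ∅ := by
        ext X; exact (hV.false (X 0)).elim
      rw [this]; exact @MeasurableSet.empty _ (MeasurableSpace.generateFrom _)
    -- a coordinate event is the union of the countably many cylinders that force it
    have : (fun X : ℕ → V => X i) ⁻¹' s =
        ⋃ c ∈ {c : (Fin (i + 1) → V) | c (Fin.last i) ∈ s},
          cyl i (fun k => if h : k < i + 1 then c ⟨k, h⟩ else v₀) := by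
      ext X
      simp only [Set.mem_preimage, Set.mem_iUnion, cyl, Set.mem_ofPred_eq, exists_prop]
      constructor
      · intro h
        exact ⟨fun k => X k, h, fun k hk => by simp [Nat.lt_succ_of_le hk]⟩
      · rintro ⟨c, hc, H⟩
        have := H i le_rfl
        rw [this]
        simpa [Fin.last] using hc
    rw [this]
    exact MeasurableSet.biUnion (Set.to_countable _) fun c _ =>
      MeasurableSpace.measurableSet_generateFrom ⟨_, _, rfl⟩
  · refine MeasurableSpace.generateFrom_le ?_
    rintro _ ⟨n, c, rfl⟩
    exact measurableSet_cyl n c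

/-- The Markov property at time `1`. -/
theorem walk_map_shift {x : V} (hdeg : ∀ x, 0 < G.degree x) :
    (walk G x).map shift = ∑ y ∈ G.neighborFinset x, (G.degree x : ℝ≥0∞)⁻¹ • walk G y := by
  have hcyl : ∀ n c, (walk G x).map shift (cyl n c) = walk G x (cyl (n + 1)
      (fun k => Nat.casesOn k x c)) := by
    intro n c
    rw [Measure.map_apply measurable_shift (measurableSet_cyl n c)]
    refine measure_congr ?_
    filter_upwards [ae_walk_zero G x] with X hX
    refine propext ⟨fun h i hi => ?_, fun h i hi => h (i + 1) (by omega)⟩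
    rcases i with _ | i
    · exact hX
    · exact h i (by omega)
  have : IsProbabilityMeasure ((walk G x).map shift) :=
    Measure.isProbabilityMeasure_map measurable_shift.aemeasurable
  have key : ∀ n c, (walk G x).map shift (cyl n c) =
      (∑ y ∈ G.neighborFinset x, (G.degree x : ℝ≥0∞)⁻¹ • walk G y) (cyl n c) := by
    intro n c
    induction n with
    | zero =>
      rw [hcyl, walk_cyl_succ, walk_cyl_zero, Measure.finsetSum_apply]
      simp only [Measure.smul_apply, walk_cyl_zero, smul_eq_mul]
      change ({x} : Set V).indicator 1 x * (step G x).toMeasure {c 0} = _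
      rw [step_toMeasure_singleton G (hdeg x)]
      by_cases h : c 0 ∈ G.neighborFinset x
      · rw [Finset.sum_eq_single_of_mem (c 0) h
          (fun b _ hb => by simp [Set.indicator, hb.symm])]
        rw [SimpleGraph.mem_neighborFinset] at h
        simp [Set.indicator, h]
      · rw [Finset.sum_eq_zero fun b hb => ?_]
        · rw [SimpleGraph.mem_neighborFinset] at h
          simp [Set.indicator, h]
        · have : c 0 ≠ b := fun e => h (e ▸ hb)
          simp [Set.indicator, this]
    | succ n ih =>
      rw [hcyl, walk_cyl_succ, ← hcyl, ih, Measure.finsetSum_apply, Measure.finsetSum_apply,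
        Finset.sum_mul]
      refine Finset.sum_congr rfl fun y _ => ?_
      simp only [Measure.smul_apply, smul_eq_mul, walk_cyl_succ, mul_assoc]
  refine ext_of_generate_finite _ generateFrom_cyl isPiSystem_cyl ?_ ?_
  · rintro _ ⟨n, c, rfl⟩
    exact key n c
  · rw [measure_univ, Measure.finsetSum_apply]
    have h0 : (G.degree x : ℝ≥0∞) ≠ 0 := by exact_mod_cast (hdeg x).ne'
    simp [ENNReal.mul_inv_cancel h0 (ENNReal.natCast_ne_top _)]

end Markov

/-! ### Hitting times -/

section HittingTimes

lemma hitTime_lt_iff {A : Set V} {X : ℕ → V} {m : ℕ∞} :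
    hitTime A X < m ↔ ∃ n : ℕ, X n ∈ A ∧ (n : ℕ∞) < m := by
  simp [hitTime, iInf_lt_iff]

lemma lt_hitTime_iff {A : Set V} {X : ℕ → V} {n : ℕ} :
    (n : ℕ∞) < hitTime A X ↔ ∀ k ≤ n, X k ∉ A := by
  rw [← not_le, ← ENat.lt_add_one_iff (ENat.natCast_ne_top n), hitTime_lt_iff]
  push Not
  refine forall_congr' fun k => ?_
  rw [← Nat.cast_one, ← Nat.cast_add, Nat.cast_le]
  exact ⟨fun h hk hA => by have := h hA; omega, fun h hA => by
    by_contra hk; exact h (by omega) hA⟩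

lemma lt_returnTime_iff {A : Set V} {X : ℕ → V} {n : ℕ} :
    (n : ℕ∞) < returnTime A X ↔ ∀ k, 1 ≤ k → k ≤ n → X k ∉ A := by
  rw [← not_le, ← ENat.lt_add_one_iff (ENat.natCast_ne_top n)]
  simp only [returnTime, iInf_lt_iff, Set.mem_ofPred_eq]
  push Not
  refine forall_congr' fun k => ?_
  rw [← Nat.cast_succ, Nat.cast_le]
  exact ⟨fun h h1 hk hA => by have := h ⟨h1, hA⟩; omega, fun h hA => by
    by_contra hk; exact h hA.1 (by omega) hA.2⟩

lemma hitTime_lt_hitTime_iff {A B : Set V} {X : ℕ → V} :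
    hitTime A X < hitTime B X ↔ ∃ n, X n ∈ A ∧ ∀ k ≤ n, X k ∉ B := by
  simp only [hitTime_lt_iff (m := hitTime B X), lt_hitTime_iff]

lemma hitTime_lt_returnTime_iff {A B : Set V} {X : ℕ → V} (h0 : X 0 ∉ A) :
    hitTime A X < returnTime B X ↔ hitTime A (shift X) < hitTime B (shift X) := by
  rw [hitTime_lt_hitTime_iff, hitTime_lt_iff]
  simp only [lt_returnTime_iff]
  constructor
  · rintro ⟨_ | n, hn, h⟩
    · exact absurd hn h0
    · exact ⟨n, hn, fun k hk => h (k + 1) (by omega) (by omega)⟩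
  · rintro ⟨n, hn, h⟩
    refine ⟨n + 1, hn, fun k h1 hk => ?_⟩
    obtain ⟨k, rfl⟩ := Nat.exists_eq_add_of_le' h1
    exact h k (by omega)

lemma hitPoint_eq_iff {B : Set V} {w : V} (hw : w ∈ B) {X : ℕ → V} :
    (hitTime B X < ⊤ ∧ hitPoint B X = w) ↔ ∃ n, X n = w ∧ ∀ k < n, X k ∉ B := by
  classical
  have key : ∀ n, X n ∈ B → (∀ k < n, X k ∉ B) → hitTime B X = n := by
    intro n hn h
    refine le_antisymm (iInf₂_le n hn) (le_iInf₂ fun k hk => ?_)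
    rw [Nat.cast_le]
    by_contra hlt
    exact h k (by omega) hk
  constructor
  · rintro ⟨h, hp⟩
    obtain ⟨n, hn, -⟩ := hitTime_lt_iff.1 h
    have hex : ∃ n, X n ∈ B := ⟨n, hn⟩
    have ht := key _ (Nat.find_spec hex) fun k hk => Nat.find_min hex hk
    refine ⟨_, ?_, fun k hk => Nat.find_min hex hk⟩
    rwa [hitPoint, ht, ENat.toNat_natCast] at hp
  · rintro ⟨n, rfl, h⟩
    have ht := key n hw h
    exact ⟨ht ▸ ENat.natCast_lt_top n, by rw [hitPoint, ht, ENat.toNat_natCast]⟩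

lemma avoid_succ_iff {A : Set V} {X : ℕ → V} (h0 : X 0 ∉ A) (n : ℕ) :
    (∀ k ≤ n + 1, X k ∉ A) ↔ ∀ k ≤ n, shift X k ∉ A := by
  constructor
  · exact fun h k hk => h (k + 1) (by omega)
  · intro h k hk
    rcases k with _ | k
    · exact h0
    · exact h k (by omega)

variable [MeasurableSpace V] [DiscreteMeasurableSpace V]

lemma measurableSet_coord (n : ℕ) (s : Set V) : MeasurableSet {X : ℕ → V | X n ∈ s} :=
  measurable_pi_apply n (MeasurableSet.of_discrete (s := s))

lemma measurableSet_avoid (A : Set V) (n : ℕ) :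
    MeasurableSet {X : ℕ → V | ∀ k ≤ n, X k ∉ A} := by
  have : {X : ℕ → V | ∀ k ≤ n, X k ∉ A} = ⋂ k ∈ Set.Iic n, {X : ℕ → V | X k ∈ Aᶜ} := by
    ext X; simp
  rw [this]
  exact MeasurableSet.biInter (Set.to_countable _) fun k _ => measurableSet_coord k _

lemma measurableSet_hitTime_lt_hitTime (A B : Set V) :
    MeasurableSet {X : ℕ → V | hitTime A X < hitTime B X} := by
  have : {X : ℕ → V | hitTime A X < hitTime B X} =
      ⋃ n, {X : ℕ → V | X n ∈ A} ∩ {X : ℕ → V | ∀ k ≤ n, X k ∉ B} := by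
    ext X; simp [hitTime_lt_hitTime_iff]
  rw [this]
  exact MeasurableSet.iUnion fun n => (measurableSet_coord n A).inter (measurableSet_avoid B n)

lemma measurableSet_hitPoint_eq (B : Set V) {w : V} (hw : w ∈ B) :
    MeasurableSet {X : ℕ → V | hitTime B X < ⊤ ∧ hitPoint B X = w} := by
  have : {X : ℕ → V | hitTime B X < ⊤ ∧ hitPoint B X = w} =
      ⋃ n, {X : ℕ → V | X n ∈ ({w} : Set V)} ∩ ⋂ k ∈ Set.Iio n, {X : ℕ → V | X k ∈ Bᶜ} := by
    ext X
    simp only [Set.mem_ofPred_eq, hitPoint_eq_iff hw]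
    simp
  rw [this]
  exact MeasurableSet.iUnion fun n => (measurableSet_coord n _).inter
    (MeasurableSet.biInter (Set.to_countable _) fun k _ => measurableSet_coord k _)

end HittingTimes

/-! ### One-step equations, the maximum principle and recurrence -/

section Harmonic

lemma mem_of_adj_closed {G : SimpleGraph V} (hconn : G.Connected) {S : Set V} {c : V} (hc : c ∈ S)
    (h : ∀ x ∈ S, ∀ y, G.Adj x y → y ∈ S) (v : V) : v ∈ S := by
  obtain ⟨p⟩ := hconn.preconnected c v
  induction p with
  | nil => exact hc
  | cons hadj _ ih => exact ih (h _ hc _ hadj)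

lemma laplacian_eq (G : SimpleGraph V) [G.LocallyFinite] (f : V → ℝ) (x : V) :
    laplacian G f x = ∑ y ∈ G.neighborFinset x, f y - G.degree x * f x := by
  simp [laplacian, Finset.sum_sub_distrib]

lemma degree_pos (G : SimpleGraph V) [G.LocallyFinite] [Infinite V] (hconn : G.Connected) (x : V) :
    0 < G.degree x := by
  obtain ⟨y, hy⟩ := exists_ne x
  obtain ⟨p⟩ := hconn.preconnected x y
  cases p with
  | nil => exact absurd rfl hy
  | cons h _ => exact (G.degree_pos_iff_exists_adj x).2 ⟨_, h⟩

variable [MeasurableSpace V] [DiscreteMeasurableSpace V] (G : SimpleGraph V) [G.LocallyFinite]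

/-- The survival probability `ℙ_w(T_A > n)`. -/
noncomputable def survival (A : Set V) (n : ℕ) (w : V) : ℝ :=
  (walk G w).real {X | ∀ k ≤ n, X k ∉ A}

lemma survival_nonneg (A : Set V) (n : ℕ) (w : V) : 0 ≤ survival G A n w := measureReal_nonneg

lemma survival_le_one (A : Set V) (n : ℕ) (w : V) : survival G A n w ≤ 1 := measureReal_le_one

variable [Countable V]

/-- The one-step equation: if, for a walk started at `x`, the event `E` says that the shifted
trajectory lies in `F`, then `ℙ_x(E)` is the average of `ℙ_y(F)` over the neighbours `y` of `x`. -/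
lemma sum_walk_eq (hdeg : ∀ x, 0 < G.degree x) {x : V} {E F : Set (ℕ → V)}
    (hF : MeasurableSet F) (h : ∀ X : ℕ → V, X 0 = x → (X ∈ E ↔ shift X ∈ F)) :
    ∑ y ∈ G.neighborFinset x, walk G y F = G.degree x * walk G x E := by
  have h1 : walk G x E = (walk G x).map shift F := by
    rw [Measure.map_apply measurable_shift hF]
    refine measure_congr ?_
    filter_upwards [ae_walk_zero G x] with X hX
    exact propext (h X hX)
  have h0 : (G.degree x : ℝ≥0∞) ≠ 0 := by exact_mod_cast (hdeg x).ne'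
  rw [h1, walk_map_shift G hdeg, Measure.finsetSum_apply]
  simp only [Measure.smul_apply, smul_eq_mul]
  rw [← Finset.mul_sum, ← mul_assoc, ENNReal.mul_inv_cancel h0 (ENNReal.natCast_ne_top _), one_mul]

lemma sum_walk_real_eq (hdeg : ∀ x, 0 < G.degree x) {x : V} {E F : Set (ℕ → V)}
    (hF : MeasurableSet F) (h : ∀ X : ℕ → V, X 0 = x → (X ∈ E ↔ shift X ∈ F)) :
    ∑ y ∈ G.neighborFinset x, (walk G y).real F = G.degree x * (walk G x).real E := by
  have := congrArg ENNReal.toReal (sum_walk_eq G hdeg hF h)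
  rwa [ENNReal.toReal_sum (fun _ _ => measure_ne_top _ _), ENNReal.toReal_mul,
    ENNReal.toReal_natCast] at this

lemma walk_real_eq_one {x : V} {E : Set (ℕ → V)} (h : ∀ X : ℕ → V, X 0 = x → X ∈ E) :
    (walk G x).real E = 1 := by
  have hE : E =ᵐ[walk G x] Set.univ := by
    refine eventuallyEq_univ.2 ?_
    filter_upwards [ae_walk_zero G x] with X hX using h X hX
  rw [measureReal_congr hE, probReal_univ]

lemma walk_real_eq_zero {x : V} {E : Set (ℕ → V)} (h : ∀ X : ℕ → V, X 0 = x → X ∉ E) :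
    (walk G x).real E = 0 := by
  rw [measureReal_def, measure_eq_zero_iff_ae_notMem.2, ENNReal.toReal_zero]
  filter_upwards [ae_walk_zero G x] with X hX using h X hX

lemma survival_of_mem {A : Set V} (n : ℕ) {w : V} (hw : w ∈ A) : survival G A n w = 0 :=
  walk_real_eq_zero G fun _ hX h => h 0 (Nat.zero_le _) (hX ▸ hw)

lemma survival_zero {A : Set V} {w : V} (hw : w ∉ A) : survival G A 0 w = 1 :=
  walk_real_eq_one G fun X hX k hk => by
    rw [Nat.le_zero.1 hk, hX]; exact hw

lemma sum_survival (hdeg : ∀ x, 0 < G.degree x) {A : Set V} (n : ℕ) {w : V} (hw : w ∉ A) :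
    ∑ y ∈ G.neighborFinset w, survival G A n y = G.degree w * survival G A (n + 1) w :=
  sum_walk_real_eq G hdeg (measurableSet_avoid A n) fun _ hX => avoid_succ_iff (hX ▸ hw) n

/-- The maximum principle for bounded functions that are subharmonic off a set which the walk
hits almost surely. -/
theorem nonpos_of_subharmonic (hdeg : ∀ x, 0 < G.degree x) {C : Set V}
    (hC : ∀ w, Tendsto (fun n => survival G C n w) atTop (𝓝 0)) {f : V → ℝ} {M : ℝ}
    (hM : ∀ w, f w ≤ M) (hfC : ∀ w ∈ C, f w ≤ 0) (hf : ∀ w ∉ C, 0 ≤ laplacian G f w) (w : V) :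
    f w ≤ 0 := by
  have key : ∀ n w, f w ≤ max M 0 * survival G C n w := by
    intro n
    induction n with
    | zero =>
      intro w
      by_cases hw : w ∈ C
      · rw [survival_of_mem G 0 hw, mul_zero]; exact hfC w hw
      · rw [survival_zero G hw, mul_one]; exact (hM w).trans (le_max_left _ _)
    | succ n ih =>
      intro w
      by_cases hw : w ∈ C
      · rw [survival_of_mem G _ hw, mul_zero]; exact hfC w hw
      · have hd : (0 : ℝ) < G.degree w := by exact_mod_cast hdeg w
        have h1 := hf w hw
        rw [laplacian_eq] at h1
        have h2 : ∑ y ∈ G.neighborFinset w, f y ≤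
            max M 0 * (G.degree w * survival G C (n + 1) w) := by
          rw [← sum_survival G hdeg n hw, Finset.mul_sum]
          exact Finset.sum_le_sum fun y _ => ih y
        refine le_of_mul_le_mul_left ?_ hd
        linarith
  have hlim := (hC w).const_mul (max M 0)
  rw [mul_zero] at hlim
  exact ge_of_tendsto' hlim fun n => key n w

/-- On a connected recurrent graph the walk hits every vertex almost surely. -/
theorem walk_never_hit_eq_zero (hdeg : ∀ x, 0 < G.degree x) (hconn : G.Connected)
    (hrec : IsRecurrent G) (c w : V) : walk G w {X | ∀ k, X k ≠ c} = 0 := by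
  have hmeas : MeasurableSet {X : ℕ → V | ∀ k, X k ≠ c} := by
    have : {X : ℕ → V | ∀ k, X k ≠ c} = ⋂ k, {X : ℕ → V | X k ∈ ({c} : Set V)ᶜ} := by
      ext X; simp
    rw [this]
    exact MeasurableSet.iInter fun k => measurableSet_coord k _
  -- the set of vertices from which `c` is hit almost surely contains `c` and is closed under `∼`
  refine mem_of_adj_closed hconn (S := {w | walk G w {X | ∀ k, X k ≠ c} = 0}) (c := c)
    ?_ ?_ w
  · refine measure_eq_zero_iff_ae_notMem.2 ?_
    filter_upwards [ae_walk_zero G c] with X hX h using h 0 hX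
  · intro x hx y hxy
    have h0 : ∑ y ∈ G.neighborFinset x, walk G y {X | ∀ k, X k ≠ c} = 0 := by
      by_cases hxc : x = c
      · subst hxc
        rw [sum_walk_eq G hdeg (E := {X | ∀ k, X (k + 1) ≠ x}) hmeas fun X _ => Iff.rfl]
        have : walk G x {X | ∀ k, X (k + 1) ≠ x} = 0 := by
          refine measure_eq_zero_iff_ae_notMem.2 ?_
          filter_upwards [hrec x] with X hX h
          obtain ⟨n, hn, hX⟩ := hX
          obtain ⟨k, rfl⟩ := Nat.exists_eq_add_of_le' hn
          exact h k hX
        rw [this, mul_zero]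
      · rw [sum_walk_eq G hdeg (E := {X | ∀ k, X k ≠ c}) hmeas fun X hX => ⟨fun h k => h (k + 1),
          fun h k => ?_⟩]
        · rw [Set.mem_ofPred_eq] at hx
          rw [hx, mul_zero]
        · rcases k with _ | k
          · rwa [hX]
          · exact h k
    exact (Finset.sum_eq_zero_iff.1 h0) y ((G.mem_neighborFinset x y).2 hxy)

theorem tendsto_survival (hdeg : ∀ x, 0 < G.degree x) (hconn : G.Connected)
    (hrec : IsRecurrent G) {C : Set V} (hC : C.Nonempty) (w : V) :
    Tendsto (fun n => survival G C n w) atTop (𝓝 0) := by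
  obtain ⟨c, hc⟩ := hC
  have h := tendsto_measure_iInter_atTop (μ := walk G w)
    (s := fun n : ℕ => {X : ℕ → V | ∀ k ≤ n, X k ∉ C})
    (fun n => (measurableSet_avoid C n).nullMeasurableSet)
    (fun n m hnm X hX k hk => hX k (hk.trans hnm)) ⟨0, measure_ne_top _ _⟩
  have h0 : walk G w (⋂ n, {X : ℕ → V | ∀ k ≤ n, X k ∉ C}) = 0 := by
    refine measure_mono_null (t := {X | ∀ k, X k ≠ c}) (fun X hX k hk => ?_)
      (walk_never_hit_eq_zero G hdeg hconn hrec c w)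
    exact Set.mem_iInter.1 hX k k le_rfl (hk ▸ hc)
  rw [h0] at h
  exact (ENNReal.tendsto_toReal ENNReal.zero_ne_top).comp h

end Harmonic

/-! ### Green's identity -/

section GreenIdentity

variable (G : SimpleGraph V) [G.LocallyFinite]

/-- The bilinear form `∑_{x ∼ y} f(x) g(y)` of the adjacency operator. -/
noncomputable def adjForm (f g : V → ℝ≥0∞) : ℝ≥0∞ :=
  ∑' x, f x * ∑ y ∈ G.neighborFinset x, g y

lemma adjForm_eq_tsum (f g : V → ℝ≥0∞) :
    adjForm G f g = ∑' x, ∑' y, {p : V × V | G.Adj p.1 p.2}.indicator (fun p => f p.1 * g p.2) (x, y)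
    := by
  refine tsum_congr fun x => ?_
  rw [Finset.mul_sum, tsum_eq_sum (s := G.neighborFinset x)]
  · refine Finset.sum_congr rfl fun y hy => ?_
    rw [SimpleGraph.mem_neighborFinset] at hy
    simp [Set.indicator, hy]
  · intro y hy
    rw [SimpleGraph.mem_neighborFinset] at hy
    simp [Set.indicator, hy]

lemma adjForm_comm (f g : V → ℝ≥0∞) : adjForm G f g = adjForm G g f := by
  rw [adjForm_eq_tsum, adjForm_eq_tsum, ENNReal.tsum_comm]
  refine tsum_congr fun x => tsum_congr fun y => ?_
  by_cases h : G.Adj x y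
  · simp [Set.indicator, h, h.symm, mul_comm]
  · have h' : ¬ G.Adj y x := fun h' => h h'.symm
    simp [Set.indicator, h, h']

lemma adjForm_add_right (f g₁ g₂ : V → ℝ≥0∞) :
    adjForm G f (g₁ + g₂) = adjForm G f g₁ + adjForm G f g₂ := by
  simp only [adjForm, Pi.add_apply, Finset.sum_add_distrib, mul_add, ENNReal.tsum_add]

lemma adjForm_tsum_right (f : V → ℝ≥0∞) (g : ℕ → V → ℝ≥0∞) :
    adjForm G f (fun x => ∑' n, g n x) = ∑' n, adjForm G f (g n) := by
  unfold adjForm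
  rw [ENNReal.tsum_comm]
  refine tsum_congr fun x => ?_
  rw [ENNReal.tsum_mul_left, Summable.tsum_finsetSum fun _ _ => ENNReal.summable]

/-- One step of simple random walk killed on entering `C`, acting on functions. -/
noncomputable def killedStep (C : Set V) (f : V → ℝ≥0∞) : V → ℝ≥0∞ :=
  Cᶜ.indicator fun x => (∑ y ∈ G.neighborFinset x, f y) / G.degree x

variable {G}

lemma degree_mul_killedStep (hdeg : ∀ x, 0 < G.degree x) {C : Set V} (f : V → ℝ≥0∞) {x : V}
    (hx : x ∉ C) : G.degree x * killedStep G C f x = ∑ y ∈ G.neighborFinset x, f y := by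
  rw [killedStep, Set.indicator_of_mem (Set.mem_compl hx)]
  exact ENNReal.mul_div_cancel (by exact_mod_cast (hdeg x).ne') (ENNReal.natCast_ne_top _)

lemma killedStep_of_mem {C : Set V} (f : V → ℝ≥0∞) {x : V} (hx : x ∈ C) :
    killedStep G C f x = 0 := by
  rw [killedStep, Set.indicator_of_notMem (Set.notMem_compl_iff.2 hx)]

lemma killedStep_add (C : Set V) (f g : V → ℝ≥0∞) :
    killedStep G C (f + g) = killedStep G C f + killedStep G C g := by
  ext x
  by_cases hx : x ∈ C
  · simp [killedStep_of_mem _ hx]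
  · simp [killedStep, Set.indicator, hx, Finset.sum_add_distrib, ENNReal.add_div]

/-- The pairing `∑_x deg(x) f(x) g(x)`. -/
noncomputable def degPairing (G : SimpleGraph V) [G.LocallyFinite] (f g : V → ℝ≥0∞) : ℝ≥0∞ :=
  ∑' x, G.degree x * f x * g x

lemma degPairing_comm (f g : V → ℝ≥0∞) : degPairing G f g = degPairing G g f :=
  tsum_congr fun x => by ring

lemma degPairing_killedStep (hdeg : ∀ x, 0 < G.degree x) {C : Set V} {f : V → ℝ≥0∞}
    (hf : ∀ x ∈ C, f x = 0) (g : V → ℝ≥0∞) :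
    degPairing G f (killedStep G C g) = adjForm G f g := by
  refine tsum_congr fun x => ?_
  by_cases hx : x ∈ C
  · simp [hf x hx]
  · rw [← degree_mul_killedStep hdeg g hx]; ring

lemma iterate_killedStep_of_mem {C : Set V} {f : V → ℝ≥0∞} (hf : ∀ x ∈ C, f x = 0) (n : ℕ) {x : V}
    (hx : x ∈ C) : (killedStep G C)^[n] f x = 0 := by
  rcases n with _ | n
  · exact hf x hx
  · rw [Function.iterate_succ_apply', killedStep_of_mem _ hx]

/-- Reversibility: the killed walk is self-adjoint for the degree pairing. -/
lemma degPairing_iterate_killedStep (hdeg : ∀ x, 0 < G.degree x) {C : Set V} (n : ℕ) :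
    ∀ {f g : V → ℝ≥0∞}, (∀ x ∈ C, f x = 0) → (∀ x ∈ C, g x = 0) →
      degPairing G f ((killedStep G C)^[n] g) = degPairing G g ((killedStep G C)^[n] f) := by
  induction n with
  | zero => exact fun _ _ => degPairing_comm _ _
  | succ n ih =>
    intro f g hf hg
    rw [Function.iterate_succ_apply, ih hf fun x hx => killedStep_of_mem _ hx, degPairing_comm,
      degPairing_killedStep hdeg (fun x hx => iterate_killedStep_of_mem hf n hx), adjForm_comm,
      ← degPairing_killedStep hdeg hg, ← Function.iterate_succ_apply' (killedStep G C)]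

variable [MeasurableSpace V] [DiscreteMeasurableSpace V] [Countable V]

lemma iterate_killedStep_le (hdeg : ∀ x, 0 < G.degree x) {C : Set V} {f : V → ℝ≥0∞} {M : ℝ≥0∞}
    (hM : ∀ x, f x ≤ M) (n : ℕ) (x : V) :
    (killedStep G C)^[n] (Cᶜ.indicator f) x ≤ M * walk G x {X | ∀ k ≤ n, X k ∉ C} := by
  have hmem : ∀ n : ℕ, ∀ x ∈ C, (killedStep G C)^[n] (Cᶜ.indicator f) x = 0 := fun n x hx =>
    iterate_killedStep_of_mem (fun y hy => Set.indicator_of_notMem (Set.notMem_compl_iff.2 hy) _) n hx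
  induction n generalizing x with
  | zero =>
    by_cases hx : x ∈ C
    · rw [hmem 0 x hx]; exact zero_le
    · have h1 : walk G x {X | ∀ k ≤ 0, X k ∉ C} = 1 := by
        have h := survival_zero G hx
        rw [survival, measureReal_def] at h
        rw [← ENNReal.ofReal_toReal (measure_ne_top (walk G x) {X | ∀ k ≤ 0, X k ∉ C}), h,
          ENNReal.ofReal_one]
      rw [h1, mul_one, Function.iterate_zero_apply]
      exact (Set.indicator_le_self _ _ _).trans (hM x)
  | succ n ih =>
    by_cases hx : x ∈ C
    · rw [hmem _ x hx]; exact zero_le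
    · rw [Function.iterate_succ_apply']
      have h0 : (G.degree x : ℝ≥0∞) ≠ 0 := by exact_mod_cast (hdeg x).ne'
      rw [← ENNReal.mul_le_mul_iff_right h0 (ENNReal.natCast_ne_top _),
        degree_mul_killedStep hdeg _ hx, mul_left_comm,
        ← sum_walk_eq G hdeg (E := {X | ∀ k ≤ n + 1, X k ∉ C}) (measurableSet_avoid C n)
          fun X hX => avoid_succ_iff (hX ▸ hx) n,
        Finset.mul_sum]
      exact Finset.sum_le_sum fun y _ => ih y

/-- A bounded function that is harmonic off a set `C` which the walk hits almost surely is
recovered off `C` from its values on `C`: the walk steps `n` times off `C` and then enters `C`. -/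
lemma indicator_compl_eq_tsum (hdeg : ∀ x, 0 < G.degree x) {C : Set V}
    (hC : ∀ w, Tendsto (fun n => survival G C n w) atTop (𝓝 0)) {f : V → ℝ≥0∞} {M : ℝ≥0∞}
    (hMtop : M ≠ ⊤) (hM : ∀ x, f x ≤ M)
    (hf : ∀ x ∉ C, ∑ y ∈ G.neighborFinset x, f y = G.degree x * f x) :
    Cᶜ.indicator f =
      fun x => ∑' n, (killedStep G C)^[n] (killedStep G C (C.indicator f)) x := by
  set r := killedStep G C (C.indicator f) with hr
  have hstep : Cᶜ.indicator f = r + killedStep G C (Cᶜ.indicator f) := by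
    rw [hr, ← killedStep_add, Set.indicator_self_add_compl]
    ext x
    by_cases hx : x ∈ C
    · rw [killedStep_of_mem _ hx, Set.indicator_of_notMem (Set.notMem_compl_iff.2 hx)]
    · have h0 : (G.degree x : ℝ≥0∞) ≠ 0 := by exact_mod_cast (hdeg x).ne'
      rw [Set.indicator_of_mem (Set.mem_compl hx), ← ENNReal.mul_right_inj h0
        (ENNReal.natCast_ne_top _), degree_mul_killedStep hdeg _ hx, hf x hx]
  have hit_add : ∀ n, ∀ g h : V → ℝ≥0∞, (killedStep G C)^[n] (g + h) =
      (killedStep G C)^[n] g + (killedStep G C)^[n] h := by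
    intro n
    induction n with
    | zero => exact fun _ _ => rfl
    | succ n ih =>
      exact fun g h => by rw [Function.iterate_succ_apply, killedStep_add, ih,
        Function.iterate_succ_apply, Function.iterate_succ_apply]
  have hn : ∀ n, Cᶜ.indicator f = (∑ k ∈ Finset.range n, (killedStep G C)^[k] r) +
      (killedStep G C)^[n] (Cᶜ.indicator f) := by
    intro n
    induction n with
    | zero => simp
    | succ n ih =>
      rw [Finset.sum_range_succ, add_assoc, Function.iterate_succ_apply, ← hit_add, ← hstep, ← ih]
  ext x
  have hlim : Tendsto (fun n => (killedStep G C)^[n] (Cᶜ.indicator f) x) atTop (𝓝 0) := by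
    have h1 : Tendsto (fun n => M * walk G x {X | ∀ k ≤ n, X k ∉ C}) atTop (𝓝 (M * 0)) := by
      refine ENNReal.Tendsto.const_mul ?_ (Or.inr hMtop)
      rw [← ENNReal.tendsto_toReal_iff (fun _ => measure_ne_top _ _) ENNReal.zero_ne_top]
      exact hC x
    rw [mul_zero] at h1
    exact tendsto_of_tendsto_of_tendsto_of_le_of_le tendsto_const_nhds h1 (fun _ => zero_le)
      fun n => iterate_killedStep_le hdeg hM n x
  have h2 := (ENNReal.tendsto_nat_tsum fun n => (killedStep G C)^[n] r x).add hlim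
  rw [add_zero] at h2
  refine tendsto_nhds_unique (tendsto_const_nhds.congr fun n => ?_) h2
  have := congrFun (hn n) x
  rwa [Pi.add_apply, Finset.sum_apply] at this

/-- Green's identity for bounded functions that are harmonic off a set which the walk hits almost
surely: there is no contribution from infinity. -/
theorem adjForm_indicator_comm (hdeg : ∀ x, 0 < G.degree x) {C : Set V}
    (hC : ∀ w, Tendsto (fun n => survival G C n w) atTop (𝓝 0)) {f g : V → ℝ≥0∞} {M : ℝ≥0∞}
    (hMtop : M ≠ ⊤) (hfM : ∀ x, f x ≤ M) (hgM : ∀ x, g x ≤ M)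
    (hf : ∀ x ∉ C, ∑ y ∈ G.neighborFinset x, f y = G.degree x * f x)
    (hg : ∀ x ∉ C, ∑ y ∈ G.neighborFinset x, g y = G.degree x * g x) :
    adjForm G (C.indicator f) g = adjForm G (C.indicator g) f := by
  have key : ∀ {f g : V → ℝ≥0∞}, (∀ x, g x ≤ M) →
      (∀ x ∉ C, ∑ y ∈ G.neighborFinset x, g y = G.degree x * g x) →
      adjForm G (C.indicator f) g = adjForm G (C.indicator f) (C.indicator g) +
        ∑' n, degPairing G (killedStep G C (C.indicator f))
          ((killedStep G C)^[n] (killedStep G C (C.indicator g))) := by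
    intro f g hgM hg
    nth_rw 1 [← Set.indicator_self_add_compl C g]
    rw [adjForm_add_right, indicator_compl_eq_tsum hdeg hC hMtop hgM hg, adjForm_tsum_right]
    congr 1
    refine tsum_congr fun n => ?_
    rw [adjForm_comm, ← degPairing_killedStep (C := C) hdeg, degPairing_comm]
    exact fun x hx => iterate_killedStep_of_mem (fun y hy => killedStep_of_mem _ hy) n hx
  rw [key hgM hg, key hfM hf, adjForm_comm]
  congr 1
  refine tsum_congr fun n => degPairing_iterate_killedStep hdeg n ?_ ?_ <;>
    exact fun x hx => killedStep_of_mem _ hx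

/-- Green's identity, in terms of the Laplacian. -/
theorem sum_mul_laplacian_comm (hdeg : ∀ x, 0 < G.degree x) {C : Finset V}
    (hC : ∀ w, Tendsto (fun n => survival G (C : Set V) n w) atTop (𝓝 0)) {f g : V → ℝ}
    (hf0 : ∀ x, 0 ≤ f x) (hg0 : ∀ x, 0 ≤ g x) (hf1 : ∀ x, f x ≤ 1) (hg1 : ∀ x, g x ≤ 1)
    (hf : ∀ x ∉ C, laplacian G f x = 0) (hg : ∀ x ∉ C, laplacian G g x = 0) :
    ∑ x ∈ C, f x * laplacian G g x = ∑ x ∈ C, g x * laplacian G f x := by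
  have hsum : ∀ {f : V → ℝ}, (∀ x, 0 ≤ f x) → ∀ x, ∑ y ∈ G.neighborFinset x, ENNReal.ofReal (f y) =
      ENNReal.ofReal (∑ y ∈ G.neighborFinset x, f y) := fun h x =>
    (ENNReal.ofReal_sum_of_nonneg fun y _ => h y).symm
  have hharm : ∀ {f : V → ℝ}, (∀ x, 0 ≤ f x) → (∀ x ∉ C, laplacian G f x = 0) →
      ∀ x ∉ (C : Set V), ∑ y ∈ G.neighborFinset x, ENNReal.ofReal (f y) =
        G.degree x * ENNReal.ofReal (f x) := by
    intro f h0 h x hx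
    have := h x hx
    rw [laplacian_eq, sub_eq_zero] at this
    rw [hsum h0, this, ENNReal.ofReal_mul (Nat.cast_nonneg _), ENNReal.ofReal_natCast]
  have hform : ∀ {f g : V → ℝ}, (∀ x, 0 ≤ f x) → (∀ x, 0 ≤ g x) →
      (adjForm G ((C : Set V).indicator fun x => ENNReal.ofReal (f x))
        fun x => ENNReal.ofReal (g x)).toReal =
      ∑ x ∈ C, f x * ∑ y ∈ G.neighborFinset x, g y := by
    intro f g hf hg
    have hg' : ∀ x, 0 ≤ ∑ y ∈ G.neighborFinset x, g y := fun x =>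
      Finset.sum_nonneg fun y _ => hg y
    rw [adjForm, tsum_eq_sum (s := C)]
    · rw [Finset.sum_congr rfl (g := fun x => ENNReal.ofReal (f x * ∑ y ∈ G.neighborFinset x, g y)),
        ← ENNReal.ofReal_sum_of_nonneg fun x _ => mul_nonneg (hf x) (hg' x),
        ENNReal.toReal_ofReal (Finset.sum_nonneg fun x _ => mul_nonneg (hf x) (hg' x))]
      intro x hx
      rw [Set.indicator_of_mem (Finset.mem_coe.2 hx), hsum hg, ENNReal.ofReal_mul (hf x)]
    · intro x hx
      rw [Set.indicator_of_notMem (fun h => hx (Finset.mem_coe.1 h)), zero_mul]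
  have hmain := adjForm_indicator_comm hdeg hC ENNReal.one_ne_top
    (fun x => ENNReal.ofReal_le_one.2 (hf1 x)) (fun x => ENNReal.ofReal_le_one.2 (hg1 x))
    (hharm hf0 hf) (hharm hg0 hg)
  have h2 := congrArg ENNReal.toReal hmain
  rw [hform hf0 hg0, hform hg0 hf0] at h2
  simp only [laplacian_eq, mul_sub, Finset.sum_sub_distrib, h2]
  congr 1
  exact Finset.sum_congr rfl fun x _ => by ring

end GreenIdentity

/-! ### Hitting probabilities and harmonic measure -/

section HittingProbabilities

variable [MeasurableSpace V] [DiscreteMeasurableSpace V] (G : SimpleGraph V) [G.LocallyFinite]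

/-- The probability `ℙ_w(T_A < T_B)`. -/
noncomputable def hitProb (A B : Set V) (w : V) : ℝ :=
  (walk G w).real {X | hitTime A X < hitTime B X}

/-- The harmonic measure `ℙ_w(T_B < ∞, X_{T_B} = b)` of `B` seen from `w`. -/
noncomputable def harmMeasure (B : Set V) (b w : V) : ℝ :=
  (walk G w).real {X | hitTime B X < ⊤ ∧ hitPoint B X = b}

lemma hitProb_nonneg (A B : Set V) (w : V) : 0 ≤ hitProb G A B w := measureReal_nonneg

lemma hitProb_le_one (A B : Set V) (w : V) : hitProb G A B w ≤ 1 := measureReal_le_one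

lemma harmMeasure_nonneg (B : Set V) (b w : V) : 0 ≤ harmMeasure G B b w := measureReal_nonneg

lemma harmMeasure_le_one (B : Set V) (b w : V) : harmMeasure G B b w ≤ 1 := measureReal_le_one

variable [Countable V]

lemma hitProb_of_mem_right {A B : Set V} {w : V} (hw : w ∈ B) : hitProb G A B w = 0 := by
  refine walk_real_eq_zero G fun X hX h => ?_
  obtain ⟨n, -, hn⟩ := hitTime_lt_hitTime_iff.1 h
  exact hn 0 (Nat.zero_le _) (hX ▸ hw)

lemma hitProb_of_mem_left {A B : Set V} {w : V} (hA : w ∈ A) (hB : w ∉ B) :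
    hitProb G A B w = 1 := by
  refine walk_real_eq_one G fun X hX => hitTime_lt_hitTime_iff.2 ⟨0, hX ▸ hA, fun k hk => ?_⟩
  rw [Nat.le_zero.1 hk, hX]; exact hB

lemma laplacian_hitProb (hdeg : ∀ x, 0 < G.degree x) {A B : Set V} {w : V} (hA : w ∉ A)
    (hB : w ∉ B) : laplacian G (hitProb G A B) w = 0 := by
  rw [laplacian_eq, sub_eq_zero]
  refine sum_walk_real_eq G hdeg (measurableSet_hitTime_lt_hitTime A B) fun X hX => ?_
  simp only [Set.mem_ofPred_eq, hitTime_lt_hitTime_iff]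
  constructor
  · rintro ⟨_ | n, hn, h⟩
    · exact absurd (hX ▸ hn) hA
    · exact ⟨n, hn, fun k hk => h (k + 1) (by omega)⟩
  · rintro ⟨n, hn, h⟩
    exact ⟨n + 1, hn, (avoid_succ_iff (hX ▸ hB) n).2 h⟩

lemma sum_hitProb (hdeg : ∀ x, 0 < G.degree x) {A : Set V} (B : Set V) {b : V} (hb : b ∉ A) :
    ∑ y ∈ G.neighborFinset b, hitProb G A B y =
      G.degree b * (walk G b).real {X | hitTime A X < returnTime B X} :=
  sum_walk_real_eq G hdeg (measurableSet_hitTime_lt_hitTime A B) fun _ hX =>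
    hitTime_lt_returnTime_iff (hX ▸ hb)

lemma harmMeasure_self {B : Set V} {b : V} (hb : b ∈ B) : harmMeasure G B b b = 1 :=
  walk_real_eq_one G fun _ hX => (hitPoint_eq_iff hb).2 ⟨0, hX, fun _ hk => absurd hk (by omega)⟩

lemma harmMeasure_of_ne {B : Set V} {b w : V} (hb : b ∈ B) (hw : w ∈ B) (h : w ≠ b) :
    harmMeasure G B b w = 0 := by
  refine walk_real_eq_zero G fun X hX hE => ?_
  obtain ⟨_ | n, hn, hk⟩ := (hitPoint_eq_iff hb).1 hE
  · exact h (hX.symm.trans hn)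
  · exact hk 0 (by omega) (hX ▸ hw)

lemma laplacian_harmMeasure (hdeg : ∀ x, 0 < G.degree x) {B : Set V} {b w : V} (hb : b ∈ B)
    (hw : w ∉ B) : laplacian G (harmMeasure G B b) w = 0 := by
  rw [laplacian_eq, sub_eq_zero]
  refine sum_walk_real_eq G hdeg (measurableSet_hitPoint_eq B hb) fun X hX => ?_
  simp only [Set.mem_ofPred_eq, hitPoint_eq_iff hb]
  constructor
  · rintro ⟨_ | n, hn, h⟩
    · exact absurd (hX ▸ hn ▸ hb) hw
    · exact ⟨n, hn, fun k hk => h (k + 1) (by omega)⟩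
  · rintro ⟨n, hn, h⟩
    refine ⟨n + 1, hn, fun k hk => ?_⟩
    rcases k with _ | k
    · rwa [hX]
    · exact h k (by omega)

lemma integral_hitPoint (hdeg : ∀ x, 0 < G.degree x) (hconn : G.Connected) (hrec : IsRecurrent G)
    {B : Finset V} (hB : B.Nonempty) (f : V → ℝ) (w : V) :
    ∫ X, f (hitPoint (B : Set V) X) ∂walk G w = ∑ b ∈ B, f b * harmMeasure G (B : Set V) b w := by
  classical
  obtain ⟨c, hc⟩ := hB
  have hhit : ∀ᵐ X ∂walk G w, hitTime (B : Set V) X < ⊤ := by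
    filter_upwards [measure_eq_zero_iff_ae_notMem.1
      (walk_never_hit_eq_zero G hdeg hconn hrec c w)] with X hX
    simp only [not_forall, not_not] at hX
    obtain ⟨k, hk⟩ := hX
    exact hitTime_lt_iff.2 ⟨k, hk ▸ hc, ENat.natCast_lt_top k⟩
  have hae : (fun X => f (hitPoint (B : Set V) X)) =ᵐ[walk G w] fun X => ∑ b ∈ B,
      {X | hitTime (B : Set V) X < ⊤ ∧ hitPoint (B : Set V) X = b}.indicator (fun _ => f b) X := by
    filter_upwards [hhit] with X hX
    have hmem : hitPoint (B : Set V) X ∈ B := by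
      obtain ⟨n, hn, -⟩ := hitTime_lt_iff.1 hX
      have hex : ∃ n, X n ∈ (B : Set V) := ⟨n, hn⟩
      have := (hitPoint_eq_iff (Nat.find_spec hex)).2 ⟨_, rfl, fun k hk => Nat.find_min hex hk⟩
      rw [this.2]
      exact Nat.find_spec hex
    rw [Finset.sum_eq_single_of_mem _ hmem]
    · simp [hX]
    · intro b _ hb
      simp [hb.symm]
  rw [integral_congr_ae hae, integral_finsetSum]
  · refine Finset.sum_congr rfl fun b hb => ?_
    rw [integral_indicator_const _ (measurableSet_hitPoint_eq _ (Finset.mem_coe.2 hb)),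
      smul_eq_mul, mul_comm]
    rfl
  · exact fun b hb => (integrable_const _).indicator
      (measurableSet_hitPoint_eq _ (Finset.mem_coe.2 hb))

/-- Within `n` steps the walk cannot reach a set at distance more than `n`. -/
lemma hitProb_le_survival (hdeg : ∀ x, 0 < G.degree x) (hconn : G.Connected) (A B : Set V)
    (n : ℕ) : ∀ w, (∀ v ∈ A, n < G.dist w v) → hitProb G A B w ≤ survival G B n w := by
  induction n with
  | zero =>
    intro w _
    by_cases hB : w ∈ B
    · rw [hitProb_of_mem_right G hB]; exact survival_nonneg _ _ _ _
    · rw [survival_zero G hB]; exact hitProb_le_one _ _ _ _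
  | succ n ih =>
    intro w hw
    by_cases hB : w ∈ B
    · rw [hitProb_of_mem_right G hB]; exact survival_nonneg _ _ _ _
    · have hA : w ∉ A := fun h => by
        have := hw w h
        rw [SimpleGraph.dist_self] at this; omega
      have hd : (0 : ℝ) < G.degree w := by exact_mod_cast hdeg w
      have h := laplacian_hitProb G hdeg hA hB
      rw [laplacian_eq, sub_eq_zero] at h
      refine le_of_mul_le_mul_left ?_ hd
      rw [← h, ← sum_survival G hdeg n hB]
      refine Finset.sum_le_sum fun y hy => ih y fun v hv => ?_
      have h1 := hw v hv
      have h2 : G.dist w v ≤ G.dist w y + G.dist y v := hconn.dist_triangle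
      rw [SimpleGraph.dist_eq_one_iff_adj.2 ((G.mem_neighborFinset w y).1 hy)] at h2
      omega

end HittingProbabilities

/-! ### The Green function -/

section Green

variable [MeasurableSpace V] [DiscreteMeasurableSpace V] (G : SimpleGraph V) [G.LocallyFinite]

lemma greenNorm_nonneg (A : Set V) (w x : V) : 0 ≤ greenNorm G A w x :=
  div_nonneg ENNReal.toReal_nonneg (Nat.cast_nonneg _)

/-- The probability `ℙ_w(n < T_A, X_n = x)`. -/
noncomputable def visit (A : Set V) (x : V) (n : ℕ) (w : V) : ℝ :=
  (walk G w).real ({X | ∀ k ≤ n, X k ∉ A} ∩ {X | X n ∈ ({x} : Set V)})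

lemma visit_nonneg (A : Set V) (x : V) (n : ℕ) (w : V) : 0 ≤ visit G A x n w := measureReal_nonneg

lemma measurableSet_visit (A : Set V) (x : V) (n : ℕ) :
    MeasurableSet ({X : ℕ → V | ∀ k ≤ n, X k ∉ A} ∩ {X : ℕ → V | X n ∈ ({x} : Set V)}) :=
  (measurableSet_avoid A n).inter (measurableSet_coord n _)

lemma green_eq_tsum (A : Set V) (x w : V) :
    green G A w x = ∑' n, ENNReal.ofReal (visit G A x n w) := by
  classical
  have hset : ∀ n : ℕ, (fun X : ℕ → V =>
      {n : ℕ | (n : ℕ∞) < hitTime A X ∧ X n = x}.indicator (1 : ℕ → ℝ≥0∞) n) =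
      ({X : ℕ → V | ∀ k ≤ n, X k ∉ A} ∩ {X : ℕ → V | X n ∈ ({x} : Set V)}).indicator 1 := by
    intro n
    ext X
    rw [Set.indicator_apply, Set.indicator_apply]
    exact if_congr (and_congr_left' lt_hitTime_iff) rfl rfl
  rw [green, lintegral_tsum]
  · refine tsum_congr fun n => ?_
    rw [hset, lintegral_indicator_one (measurableSet_visit A x n), visit, ofReal_measureReal]
  · intro n
    rw [hset]
    exact (measurable_one.indicator (measurableSet_visit A x n)).aemeasurable

variable [Countable V]

lemma visit_of_mem {A : Set V} (x : V) (n : ℕ) {w : V} (hw : w ∈ A) : visit G A x n w = 0 :=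
  walk_real_eq_zero G fun _ hX h => h.1 0 (Nat.zero_le _) (hX ▸ hw)

lemma visit_zero [DecidableEq V] {A : Set V} (x : V) {w : V} (hw : w ∉ A) :
    visit G A x 0 w = if w = x then 1 else 0 := by
  split_ifs with h
  · refine walk_real_eq_one G fun X hX => ⟨fun k hk => ?_, hX.trans h⟩
    rw [Nat.le_zero.1 hk, hX]; exact hw
  · exact walk_real_eq_zero G fun X hX hE => h (hX.symm.trans hE.2)

lemma sum_visit (hdeg : ∀ x, 0 < G.degree x) {A : Set V} (x : V) (n : ℕ) {w : V} (hw : w ∉ A) :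
    ∑ y ∈ G.neighborFinset w, visit G A x n y = G.degree w * visit G A x (n + 1) w :=
  sum_walk_real_eq G hdeg (measurableSet_visit A x n) fun _ hX =>
    and_congr_left' (avoid_succ_iff (hX ▸ hw) n)

/-- The expected number of visits to `x` before hitting `A` is bounded in the starting point: after
each visit to `x` the walk hits `A` within `N` steps with probability at least `1/2`, and the time
at which it hits `A` lies in at most `N` windows `(n, n + N]`. -/
lemma exists_sum_visit_le (hdeg : ∀ x, 0 < G.degree x) {A : Set V}
    (hA : ∀ w, Tendsto (fun n => survival G A n w) atTop (𝓝 0)) (x : V) :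
    ∃ K : ℝ, ∀ m w, ∑ n ∈ Finset.range m, visit G A x n w ≤ K := by
  classical
  obtain ⟨N, hN⟩ := ((hA x).eventually (gt_mem_nhds (show (0 : ℝ) < 1 / 2 by norm_num))).exists
  have key : ∀ n w, 1 / 2 * visit G A x n w + survival G A (N + n) w ≤ survival G A n w := by
    intro n
    induction n with
    | zero =>
      intro w
      by_cases hw : w ∈ A
      · simp [visit_of_mem G x _ hw, survival_of_mem G _ hw]
      · rw [visit_zero G x hw, survival_zero G hw, add_zero]
        split_ifs with h
        · subst h; linarith
        · simpa using survival_le_one G A N w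
    | succ n ih =>
      intro w
      by_cases hw : w ∈ A
      · simp [visit_of_mem G x _ hw, survival_of_mem G _ hw]
      · have hd : (0 : ℝ) < G.degree w := by exact_mod_cast hdeg w
        refine le_of_mul_le_mul_left ?_ hd
        rw [mul_add, mul_left_comm, ← sum_visit G hdeg x n hw, ← add_assoc,
          ← sum_survival G hdeg _ hw, ← sum_survival G hdeg _ hw, Finset.mul_sum,
          ← Finset.sum_add_distrib]
        exact Finset.sum_le_sum fun y _ => ih y
  refine ⟨2 * N, fun m w => ?_⟩
  have h1 := Finset.sum_le_sum fun n (_ : n ∈ Finset.range m) => key n w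
  rw [Finset.sum_add_distrib, ← Finset.mul_sum] at h1
  have h2 : ∑ n ∈ Finset.range m, survival G A n w ≤
      ∑ n ∈ Finset.range (N + m), survival G A n w :=
    Finset.sum_le_sum_of_subset_of_nonneg (Finset.range_mono (by omega))
      fun n _ _ => survival_nonneg G A n w
  rw [Finset.sum_range_add] at h2
  have h3 : ∑ n ∈ Finset.range N, survival G A n w ≤ N := by
    simpa using Finset.sum_le_sum fun n (_ : n ∈ Finset.range N) => survival_le_one G A n w
  linarith

lemma summable_visit (hdeg : ∀ x, 0 < G.degree x) {A : Set V}
    (hA : ∀ w, Tendsto (fun n => survival G A n w) atTop (𝓝 0)) (x w : V) :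
    Summable fun n => visit G A x n w := by
  obtain ⟨K, hK⟩ := exists_sum_visit_le G hdeg hA x
  exact summable_of_sum_range_le (fun _ => measureReal_nonneg) fun m => hK m w

lemma toReal_green (hdeg : ∀ x, 0 < G.degree x) {A : Set V}
    (hA : ∀ w, Tendsto (fun n => survival G A n w) atTop (𝓝 0)) (x w : V) :
    (green G A w x).toReal = ∑' n, visit G A x n w := by
  rw [green_eq_tsum, ← ENNReal.ofReal_tsum_of_nonneg (fun _ => visit_nonneg G A x _ w)
    (summable_visit G hdeg hA x w),
    ENNReal.toReal_ofReal (tsum_nonneg fun _ => visit_nonneg G A x _ w)]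

lemma greenNorm_of_mem (hdeg : ∀ x, 0 < G.degree x) {A : Set V}
    (hA : ∀ w, Tendsto (fun n => survival G A n w) atTop (𝓝 0)) (x : V) {w : V} (hw : w ∈ A) :
    greenNorm G A w x = 0 := by
  simp [greenNorm, toReal_green G hdeg hA, visit_of_mem G x _ hw]

lemma exists_greenNorm_le (hdeg : ∀ x, 0 < G.degree x) {A : Set V}
    (hA : ∀ w, Tendsto (fun n => survival G A n w) atTop (𝓝 0)) (x : V) :
    ∃ K : ℝ, ∀ w, greenNorm G A w x ≤ K := by
  obtain ⟨K, hK⟩ := exists_sum_visit_le G hdeg hA x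
  refine ⟨K / G.degree x, fun w => ?_⟩
  rw [greenNorm, toReal_green G hdeg hA]
  exact div_le_div_of_nonneg_right (Real.tsum_le_of_sum_range_le (fun _ => measureReal_nonneg)
    fun m => hK m w) (Nat.cast_nonneg _)

lemma laplacian_greenNorm [DecidableEq V] (hdeg : ∀ x, 0 < G.degree x) {A : Set V}
    (hA : ∀ w, Tendsto (fun n => survival G A n w) atTop (𝓝 0)) (x : V) {w : V} (hw : w ∉ A) :
    laplacian G (fun v => greenNorm G A v x) w = if w = x then -1 else 0 := by
  have hx : (G.degree x : ℝ) ≠ 0 := by exact_mod_cast (hdeg x).ne'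
  have h1 : ∑ y ∈ G.neighborFinset w, (green G A y x).toReal =
      G.degree w * ((green G A w x).toReal - if w = x then 1 else 0) := by
    simp only [toReal_green G hdeg hA]
    rw [← Summable.tsum_finsetSum fun y _ => summable_visit G hdeg hA x y,
      (summable_visit G hdeg hA x w).tsum_eq_zero_add, visit_zero G x hw, add_sub_cancel_left,
      ← tsum_mul_left]
    exact tsum_congr fun n => sum_visit G hdeg x n hw
  rw [laplacian_eq]
  simp only [greenNorm]
  rw [← Finset.sum_div, h1]
  split_ifs with h
  · subst h; field_simp; ring
  · ring

lemma laplacian_truncKernel [DecidableEq V] (hdeg : ∀ x, 0 < G.degree x) {A : Set V}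
    (hA : ∀ w, Tendsto (fun n => survival G A n w) atTop (𝓝 0)) (x : V) {w : V} (hw : w ∉ A) :
    laplacian G (fun v => truncKernel G A v x) w = if w = x then 1 else 0 := by
  have h := laplacian_greenNorm G hdeg hA x hw
  have : laplacian G (fun v => truncKernel G A v x) w =
      - laplacian G (fun v => greenNorm G A v x) w := by
    simp only [laplacian, truncKernel, ← Finset.sum_neg_distrib]
    exact Finset.sum_congr rfl fun y _ => by ring
  rw [this, h]
  split_ifs <;> simp

end Green

/-! ### Linearity of the Laplacian -/

section Laplacian

variable (G : SimpleGraph V) [G.LocallyFinite]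

lemma laplacian_sub (f g : V → ℝ) (x : V) :
    laplacian G (fun v => f v - g v) x = laplacian G f x - laplacian G g x := by
  simp only [laplacian, ← Finset.sum_sub_distrib]
  exact Finset.sum_congr rfl fun y _ => by ring

lemma laplacian_neg (f : V → ℝ) (x : V) :
    laplacian G (fun v => - f v) x = - laplacian G f x := by
  simp only [laplacian, ← Finset.sum_neg_distrib]
  exact Finset.sum_congr rfl fun y _ => by ring

lemma laplacian_const_mul (c : ℝ) (f : V → ℝ) (x : V) :
    laplacian G (fun v => c * f v) x = c * laplacian G f x := by
  simp only [laplacian, Finset.mul_sum]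
  exact Finset.sum_congr rfl fun y _ => by ring

lemma laplacian_sum {ι : Type*} (s : Finset ι) (f : ι → V → ℝ) (x : V) :
    laplacian G (fun v => ∑ i ∈ s, f i v) x = ∑ i ∈ s, laplacian G (f i) x := by
  simp only [laplacian]
  rw [Finset.sum_comm]
  exact Finset.sum_congr rfl fun y _ => (Finset.sum_sub_distrib ..).symm

lemma tendsto_laplacian {u : ℕ → V → ℝ} {f : V → ℝ}
    (h : ∀ v, Tendsto (fun n => u n v) atTop (𝓝 (f v))) (x : V) :
    Tendsto (fun n => laplacian G (u n) x) atTop (𝓝 (laplacian G f x)) :=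
  tendsto_finsetSum _ fun y _ => (h y).sub (h x)

end Laplacian

/-! ### Sets going to infinity -/

section GoesToInfinity

variable {G : SimpleGraph V}

lemma finite_setOf_walk_length [G.LocallyFinite] (n : ℕ) :
    ∀ o : V, {v | ∃ p : G.Walk o v, p.length = n}.Finite := by
  induction n with
  | zero =>
    refine fun o => (Set.finite_singleton o).subset ?_
    rintro v ⟨p, hp⟩
    exact (SimpleGraph.Walk.eq_of_length_eq_zero hp).symm
  | succ n ih =>
    intro o
    refine (Set.Finite.biUnion (G.neighborFinset o).finite_toSet fun u _ => ih u).subset ?_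
    rintro v ⟨p, hp⟩
    cases p with
    | nil => simp at hp
    | cons h p =>
      exact Set.mem_biUnion (Finset.mem_coe.2 ((G.mem_neighborFinset _ _).2 h))
        ⟨p, by simpa using hp⟩

lemma exists_le_dist [Infinite V] [G.LocallyFinite] (hconn : G.Connected) (o : V) (r : ℕ) :
    ∃ v, r ≤ G.dist o v := by
  have hfin : (⋃ n ∈ Finset.range r, {v | ∃ p : G.Walk o v, p.length = n}).Finite :=
    Set.Finite.biUnion (Finset.range r).finite_toSet fun n _ => finite_setOf_walk_length n o
  obtain ⟨v, hv⟩ := hfin.exists_notMem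
  refine ⟨v, ?_⟩
  by_contra hlt
  obtain ⟨p, hp⟩ := hconn.exists_walk_length_eq_dist o v
  exact hv (Set.mem_biUnion (Finset.mem_coe.2 (Finset.mem_range.2 (not_le.1 hlt))) ⟨p, hp⟩)

lemma goesToInfinity_singleton (hconn : G.Connected) {z : ℕ → V} {o : V}
    (hz : Tendsto (fun n => G.dist o (z n)) atTop atTop) : GoesToInfinity G fun n => {z n} := by
  refine ⟨fun n => Finset.singleton_nonempty _, fun o' r => ?_⟩
  filter_upwards [hz.eventually_ge_atTop (r + G.dist o o')] with n hn v hv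
  rw [Finset.mem_singleton.1 hv]
  have : G.dist o (z n) ≤ G.dist o o' + G.dist o' (z n) := hconn.dist_triangle
  omega

lemma exists_goesToInfinity [Infinite V] [G.LocallyFinite] (hconn : G.Connected) :
    ∃ A : ℕ → Finset V, GoesToInfinity G A := by
  obtain ⟨o⟩ := hconn.nonempty
  choose z hz using exists_le_dist hconn o
  exact ⟨_, goesToInfinity_singleton hconn (tendsto_atTop_mono hz tendsto_id)⟩

lemma GoesToInfinity.eventually_notMem {A : ℕ → Finset V} (hA : GoesToInfinity G A) (w : V) :
    ∀ᶠ n in atTop, w ∉ A n := by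
  filter_upwards [hA.2 w 1] with n hn hw
  have := hn w hw
  rw [SimpleGraph.dist_self] at this
  omega

lemma GoesToInfinity.eventually_forall_notMem {A : ℕ → Finset V} (hA : GoesToInfinity G A)
    (B : Finset V) : ∀ᶠ n in atTop, ∀ b ∈ B, b ∉ A n :=
  (B.eventually_all).2 fun b _ => hA.eventually_notMem b

end GoesToInfinity

/-! ### Asymptotics for a set going to infinity -/

section Gluing

variable [MeasurableSpace V] [DiscreteMeasurableSpace V] [Countable V]
  (G : SimpleGraph V) [G.LocallyFinite]

/-- The maximum principle, as a comparison of two bounded functions harmonic off `C`. -/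
lemma abs_le_mul_of_harmonic (hdeg : ∀ x, 0 < G.degree x) {C : Set V}
    (hC : ∀ w, Tendsto (fun n => survival G C n w) atTop (𝓝 0)) {φ h : V → ℝ} {K M : ℝ}
    (hM : 0 ≤ M) (hφK : ∀ w, |φ w| ≤ K) (hh : ∀ w, 0 ≤ h w) (hφC : ∀ w ∈ C, |φ w| ≤ M * h w)
    (hφ : ∀ w ∉ C, laplacian G φ w = 0) (hhC : ∀ w ∉ C, laplacian G h w = 0) (w : V) :
    |φ w| ≤ M * h w := by
  have h1 := nonpos_of_subharmonic G hdeg hC (f := fun v => φ v - M * h v) (M := K)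
    (fun v => by have := (abs_le.1 (hφK v)).2; have := mul_nonneg hM (hh v); linarith)
    (fun v hv => by have := (abs_le.1 (hφC v hv)).2; linarith)
    (fun v hv => by rw [laplacian_sub, laplacian_const_mul, hφ v hv, hhC v hv]; simp) w
  have h2 := nonpos_of_subharmonic G hdeg hC (f := fun v => - φ v - M * h v) (M := K)
    (fun v => by have := (abs_le.1 (hφK v)).1; have := mul_nonneg hM (hh v); linarith)
    (fun v hv => by have := (abs_le.1 (hφC v hv)).1; linarith)
    (fun v hv => by
      rw [laplacian_sub, laplacian_neg, laplacian_const_mul, hφ v hv, hhC v hv]; simp) w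
  exact abs_le.2 ⟨by linarith, by linarith⟩

lemma tendsto_hitProb (hdeg : ∀ x, 0 < G.degree x) (hconn : G.Connected) (hrec : IsRecurrent G)
    {B : Set V} (hB : B.Nonempty) {A : ℕ → Finset V} (hA : GoesToInfinity G A) (w : V) :
    Tendsto (fun n => hitProb G (A n : Set V) B w) atTop (𝓝 0) := by
  refine tendsto_order.2 ⟨fun a ha => Eventually.of_forall fun n =>
    ha.trans_le (hitProb_nonneg _ _ _ _), fun ε hε => ?_⟩
  obtain ⟨N, hN⟩ := ((tendsto_survival G hdeg hconn hrec hB w).eventually (gt_mem_nhds hε)).exists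
  filter_upwards [hA.2 w (N + 1)] with n hn
  exact (hitProb_le_survival G hdeg hconn _ B N w fun v hv => hn v hv).trans_lt hN

/-- For `x ∈ B`, the function `a_A(w, x) - 𝔼_w[a_A(X_{T_B}, x)]` is `g_A(x, x) ℙ_w(T_A < T_B)` up to
an error which is small when `A` is far away: both are harmonic off `A ∪ B`, they agree on `B`, and
on `A \ B` they differ by `𝔼_w[a_A(X_{T_B}, x)]`. -/
lemma abs_truncKernel_sub_le (hdeg : ∀ x, 0 < G.degree x) (hconn : G.Connected)
    (hrec : IsRecurrent G) {A B : Finset V} (hA : A.Nonempty) {x : V} (hx : x ∈ B) (w : V) :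
    |truncKernel G (A : Set V) w x
        - ∑ b ∈ B, truncKernel G (A : Set V) b x * harmMeasure G (B : Set V) b w
        - greenNorm G (A : Set V) x x * hitProb G (A : Set V) (B : Set V) w| ≤
      (∑ b ∈ B, |truncKernel G (A : Set V) b x|) * hitProb G (A : Set V) (B : Set V) w := by
  classical
  have hsA : ∀ w, Tendsto (fun n => survival G (A : Set V) n w) atTop (𝓝 0) :=
    tendsto_survival G hdeg hconn hrec (Finset.coe_nonempty.2 hA)
  have hsC : ∀ w, Tendsto (fun n => survival G ((A : Set V) ∪ B) n w) atTop (𝓝 0) :=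
    tendsto_survival G hdeg hconn hrec ((Finset.coe_nonempty.2 hA).inl)
  obtain ⟨K, hK⟩ := exists_greenNorm_le G hdeg hsA x
  have hsum : ∀ w, |∑ b ∈ B, truncKernel G (A : Set V) b x * harmMeasure G (B : Set V) b w| ≤
      ∑ b ∈ B, |truncKernel G (A : Set V) b x| := fun w => by
    refine (Finset.abs_sum_le_sum_abs _ _).trans (Finset.sum_le_sum fun b _ => ?_)
    rw [abs_mul, abs_of_nonneg (harmMeasure_nonneg G (B : Set V) b w)]
    exact mul_le_of_le_one_right (abs_nonneg _) (harmMeasure_le_one _ _ _ _)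
  refine abs_le_mul_of_harmonic G hdeg hsC (φ := fun w => truncKernel G (A : Set V) w x
        - ∑ b ∈ B, truncKernel G (A : Set V) b x * harmMeasure G (B : Set V) b w
        - greenNorm G (A : Set V) x x * hitProb G (A : Set V) (B : Set V) w)
    (h := hitProb G (A : Set V) (B : Set V)) (K := K + K + ∑ b ∈ B, |truncKernel G (A : Set V) b x|)
    (Finset.sum_nonneg fun b _ => abs_nonneg _) ?_ (hitProb_nonneg G _ _) ?_ ?_ ?_ w
  · intro v
    have h1 := abs_le.1 (hsum v)
    have h2 := hK v
    have h3 := hK x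
    have h4 := greenNorm_nonneg G (A : Set V) v x
    have h5 := greenNorm_nonneg G (A : Set V) x x
    have h6 : greenNorm G (A : Set V) x x * hitProb G (A : Set V) (B : Set V) v ≤
        greenNorm G (A : Set V) x x := mul_le_of_le_one_right h5 (hitProb_le_one _ _ _ _)
    have h7 := mul_nonneg h5 (hitProb_nonneg G (A : Set V) (B : Set V) v)
    have h8 : truncKernel G (A : Set V) v x =
      greenNorm G (A : Set V) x x - greenNorm G (A : Set V) v x := rfl
    refine abs_le.2 ⟨?_, ?_⟩ <;> rw [h8] <;> linarith [h1.1, h1.2]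
  · rintro v hv
    by_cases hvB : v ∈ B
    · rw [hitProb_of_mem_right G (Finset.mem_coe.2 hvB), Finset.sum_eq_single_of_mem v hvB,
        harmMeasure_self G (Finset.mem_coe.2 hvB)]
      · simp
      · intro b hb hbv
        rw [harmMeasure_of_ne G (Finset.mem_coe.2 hb) (Finset.mem_coe.2 hvB) hbv.symm, mul_zero]
    · have hvA : v ∈ (A : Set V) := hv.resolve_right hvB
      rw [hitProb_of_mem_left G hvA (fun h => hvB (Finset.mem_coe.1 h)), truncKernel,
        greenNorm_of_mem G hdeg hsA x hvA, sub_zero, mul_one, mul_one, sub_sub_cancel_left, abs_neg]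
      exact hsum v
  · intro v hv
    rw [Set.mem_union, not_or] at hv
    have hvx : v ≠ x := fun h => hv.2 (h ▸ hx)
    rw [laplacian_sub, laplacian_sub, laplacian_const_mul, laplacian_sum,
      laplacian_hitProb G hdeg hv.1 hv.2, laplacian_truncKernel G hdeg hsA x hv.1, if_neg hvx,
      Finset.sum_eq_zero]
    · simp
    · intro b hb
      rw [laplacian_const_mul, laplacian_harmMeasure G hdeg (Finset.mem_coe.2 hb) hv.2, mul_zero]
  · intro v hv
    rw [Set.mem_union, not_or] at hv
    exact laplacian_hitProb G hdeg hv.1 hv.2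

/-- The function `w ↦ a(w, x) - 𝔼_w[a(X_{T_B}, x)]`, the expectation being written as a sum over the
harmonic measure. -/
noncomputable def hitPotential (a : V → V → ℝ) (B : Finset V) (x w : V) : ℝ :=
  a w x - ∑ b ∈ B, a b x * harmMeasure G (B : Set V) b w

lemma hitPotential_of_mem (a : V → V → ℝ) {B : Finset V} (x : V) {w : V} (hw : w ∈ B) :
    hitPotential G a B x w = 0 := by
  rw [hitPotential, Finset.sum_eq_single_of_mem w hw, harmMeasure_self G (Finset.mem_coe.2 hw),
    mul_one, sub_self]
  intro b hb hbw
  rw [harmMeasure_of_ne G (Finset.mem_coe.2 hb) (Finset.mem_coe.2 hw) hbw.symm, mul_zero]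

lemma tendsto_greenNorm_mul_hitProb (hdeg : ∀ x, 0 < G.degree x) (hconn : G.Connected)
    (hrec : IsRecurrent G) {a : V → V → ℝ} (ha : IsPotentialKernel G a) {A : ℕ → Finset V}
    (hA : GoesToInfinity G A) {B : Finset V} {x : V} (hx : x ∈ B) (w : V) :
    Tendsto (fun n => greenNorm G (A n : Set V) x x * hitProb G (A n : Set V) (B : Set V) w) atTop
      (𝓝 (hitPotential G a B x w)) := by
  have hB : B.Nonempty := ⟨x, hx⟩
  have h1 : Tendsto (fun n => truncKernel G (A n : Set V) w x
      - ∑ b ∈ B, truncKernel G (A n : Set V) b x * harmMeasure G (B : Set V) b w) atTop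
      (𝓝 (hitPotential G a B x w)) :=
    (ha A hA w x).sub (tendsto_finsetSum _ fun b _ => (ha A hA b x).mul_const _)
  have h2 : Tendsto (fun n => (∑ b ∈ B, |truncKernel G (A n : Set V) b x|) *
      hitProb G (A n : Set V) (B : Set V) w) atTop (𝓝 ((∑ b ∈ B, |a b x|) * 0)) :=
    (tendsto_finsetSum _ fun b _ => (ha A hA b x).abs).mul
      (tendsto_hitProb G hdeg hconn hrec (Finset.coe_nonempty.2 hB) hA w)
  rw [mul_zero] at h2
  have h3 := squeeze_zero_norm' (f := fun n => truncKernel G (A n : Set V) w x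
      - ∑ b ∈ B, truncKernel G (A n : Set V) b x * harmMeasure G (B : Set V) b w
      - greenNorm G (A n : Set V) x x * hitProb G (A n : Set V) (B : Set V) w)
    (a := fun n => (∑ b ∈ B, |truncKernel G (A n : Set V) b x|) *
      hitProb G (A n : Set V) (B : Set V) w) (Eventually.of_forall fun n =>
    abs_truncKernel_sub_le G hdeg hconn hrec (hA.1 n) hx w) h2
  simpa using h1.sub h3

lemma laplacian_potentialKernel [DecidableEq V] (hdeg : ∀ x, 0 < G.degree x) (hconn : G.Connected)
    (hrec : IsRecurrent G) {a : V → V → ℝ} (ha : IsPotentialKernel G a) {A : ℕ → Finset V}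
    (hA : GoesToInfinity G A) (x w : V) :
    laplacian G (fun v => a v x) w = if w = x then 1 else 0 := by
  refine tendsto_nhds_unique (tendsto_laplacian G (fun v => ha A hA v x) w) ?_
  refine tendsto_const_nhds.congr' ?_
  filter_upwards [hA.eventually_notMem w] with n hn
  exact (laplacian_truncKernel G hdeg (tendsto_survival G hdeg hconn hrec
    (Finset.coe_nonempty.2 (hA.1 n))) x fun h => hn (Finset.mem_coe.1 h)).symm

/-- The harmonic measures have total flux zero: by reversibility the degree is an invariant measure
of the walk observed on `B`. -/
lemma sum_laplacian_harmMeasure (hdeg : ∀ x, 0 < G.degree x) (hconn : G.Connected)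
    (hrec : IsRecurrent G) {B : Finset V} {b : V} (hb : b ∈ B) :
    ∑ x ∈ B, laplacian G (harmMeasure G (B : Set V) b) x = 0 := by
  have hs := tendsto_survival G hdeg hconn hrec (Finset.coe_nonempty.2 ⟨b, hb⟩)
  have h1 : ∀ x, laplacian G (fun _ => (1 : ℝ)) x = 0 := fun x => by simp [laplacian]
  have := sum_mul_laplacian_comm hdeg hs (f := fun _ => 1) (g := harmMeasure G (B : Set V) b)
    (fun _ => zero_le_one) (harmMeasure_nonneg G _ b) (fun _ => le_rfl) (harmMeasure_le_one G _ b)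
    (fun x _ => h1 x) fun x hx => laplacian_harmMeasure G hdeg (Finset.mem_coe.2 hb) hx
  simpa [h1] using this

/-- The total flux of `w ↦ a(w, x) - 𝔼_w[a(X_{T_B}, x)]` out of `B` is one. -/
lemma sum_laplacian_hitPotential (hdeg : ∀ x, 0 < G.degree x) (hconn : G.Connected)
    (hrec : IsRecurrent G) {a : V → V → ℝ} (ha : IsPotentialKernel G a) {A : ℕ → Finset V}
    (hA : GoesToInfinity G A) {B : Finset V} {x : V} (hx : x ∈ B) :
    ∑ b ∈ B, laplacian G (hitPotential G a B x) b = 1 := by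
  classical
  unfold hitPotential
  simp only [laplacian_sub, laplacian_sum, laplacian_const_mul, Finset.sum_sub_distrib,
    laplacian_potentialKernel G hdeg hconn hrec ha hA]
  rw [Finset.sum_comm]
  simp only [← Finset.mul_sum]
  rw [Finset.sum_ite_eq' B x, if_pos hx, Finset.sum_eq_zero, sub_zero]
  intro b hb
  rw [sum_laplacian_harmMeasure G hdeg hconn hrec hb, mul_zero]

lemma inv_effRes (hdeg : ∀ x, 0 < G.degree x) {A B : Finset V} (hAB : ∀ b ∈ B, b ∉ A) :
    (effRes G B A)⁻¹ = ∑ b ∈ B, laplacian G (hitProb G (A : Set V) (B : Set V)) b := by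
  rw [effRes, inv_inv]
  refine Finset.sum_congr rfl fun b hb => ?_
  rw [laplacian_eq, hitProb_of_mem_right G (Finset.mem_coe.2 hb), mul_zero, sub_zero]
  exact (sum_hitProb G hdeg _ fun h => hAB b hb (Finset.mem_coe.1 h)).symm

/-- The Green function `g_A(x, x)` and the effective resistance between `A` and `B` are asymptotic
to each other when `A` goes to infinity. -/
lemma tendsto_greenNorm_mul_inv_effRes (hdeg : ∀ x, 0 < G.degree x) (hconn : G.Connected)
    (hrec : IsRecurrent G) {a : V → V → ℝ} (ha : IsPotentialKernel G a) {A : ℕ → Finset V}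
    (hA : GoesToInfinity G A) {B : Finset V} {x : V} (hx : x ∈ B) :
    Tendsto (fun n => greenNorm G (A n : Set V) x x * (effRes G B (A n))⁻¹) atTop (𝓝 1) := by
  rw [← sum_laplacian_hitPotential G hdeg hconn hrec ha hA hx]
  refine Tendsto.congr' ?_ (tendsto_finsetSum B fun b _ => tendsto_laplacian G
    (tendsto_greenNorm_mul_hitProb G hdeg hconn hrec ha hA hx) b)
  filter_upwards [hA.eventually_forall_notMem B] with n hn
  simp only [inv_effRes G hdeg hn, Finset.mul_sum, laplacian_const_mul]

lemma eventually_effRes_ne_zero (hdeg : ∀ x, 0 < G.degree x) (hconn : G.Connected)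
    (hrec : IsRecurrent G) {a : V → V → ℝ} (ha : IsPotentialKernel G a) {A : ℕ → Finset V}
    (hA : GoesToInfinity G A) {B : Finset V} (hB : B.Nonempty) :
    ∀ᶠ n in atTop, effRes G B (A n) ≠ 0 := by
  obtain ⟨x, hx⟩ := hB
  filter_upwards [(tendsto_greenNorm_mul_inv_effRes G hdeg hconn hrec ha hA hx).eventually_ne
    one_ne_zero] with n hn h
  exact hn (by rw [h, inv_zero, mul_zero])

theorem tendsto_effRes_mul_hitProb (hdeg : ∀ x, 0 < G.degree x) (hconn : G.Connected)
    (hrec : IsRecurrent G) {a : V → V → ℝ} (ha : IsPotentialKernel G a) {A : ℕ → Finset V}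
    (hA : GoesToInfinity G A) {B : Finset V} {x : V} (hx : x ∈ B) (w : V) :
    Tendsto (fun n => effRes G B (A n) * hitProb G (A n : Set V) (B : Set V) w) atTop
      (𝓝 (hitPotential G a B x w)) := by
  have h1 := tendsto_greenNorm_mul_inv_effRes G hdeg hconn hrec ha hA hx
  have h2 := (tendsto_greenNorm_mul_hitProb G hdeg hconn hrec ha hA hx w).div h1 one_ne_zero
  rw [div_one] at h2
  refine h2.congr' ?_
  filter_upwards [h1.eventually_ne one_ne_zero] with n hn
  have hg := left_ne_zero_of_mul hn
  have hr := inv_eq_zero.not.1 (right_ne_zero_of_mul hn)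
  simp only [Pi.div_apply]
  field_simp

/-- The probability that the walk from `z` enters `B` at `w` is the share of `w` in the total flux
of `ℙ_·(T_z < T_B)` out of `B`. This is Green's identity for `ℙ_·(X_{T_B} = w)` and `ℙ_·(T_z < T_B)`,
which are both harmonic off `B ∪ {z}`. -/
lemma harmMeasure_eq (hdeg : ∀ x, 0 < G.degree x) (hconn : G.Connected) (hrec : IsRecurrent G)
    {B : Finset V} {w z : V} (hw : w ∈ B) (hz : z ∉ B) :
    harmMeasure G (B : Set V) w z *
        ∑ b ∈ B, laplacian G (hitProb G {z} (B : Set V)) b =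
      laplacian G (hitProb G {z} (B : Set V)) w := by
  classical
  set h := hitProb G {z} (B : Set V) with hh
  have hC : ((insert z B : Finset V) : Set V).Nonempty := ⟨z, by simp⟩
  have hs := tendsto_survival G hdeg hconn hrec hC
  have hharm : ∀ x ∉ insert z B, laplacian G h x = 0 := fun x hx => by
    rw [Finset.mem_insert, not_or] at hx
    exact laplacian_hitProb G hdeg hx.1 hx.2
  have h1 : ∀ x, laplacian G (fun _ => (1 : ℝ)) x = 0 := fun x => by simp [laplacian]
  -- the total flux of `h` vanishes
  have hflux := sum_mul_laplacian_comm hdeg hs (f := fun _ => 1) (g := h) (fun _ => zero_le_one)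
    (hitProb_nonneg G _ _) (fun _ => le_rfl) (hitProb_le_one G _ _) (fun x _ => h1 x) hharm
  have hgreen := sum_mul_laplacian_comm hdeg hs (f := harmMeasure G (B : Set V) w) (g := h)
    (harmMeasure_nonneg G _ w) (hitProb_nonneg G _ _) (harmMeasure_le_one G _ w)
    (hitProb_le_one G _ _)
    (fun x hx => laplacian_harmMeasure G hdeg (Finset.mem_coe.2 hw) fun h =>
      hx (Finset.mem_insert_of_mem h)) hharm
  rw [Finset.sum_insert hz, Finset.sum_insert hz] at hflux hgreen
  simp only [h1, mul_zero, one_mul, Finset.sum_const_zero, add_zero] at hflux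
  rw [laplacian_harmMeasure G hdeg (Finset.mem_coe.2 hw) fun h => hz (Finset.mem_coe.1 h), mul_zero,
    zero_add, Finset.sum_eq_single_of_mem w hw, harmMeasure_self G (Finset.mem_coe.2 hw), one_mul,
    Finset.sum_eq_zero] at hgreen
  · linear_combination harmMeasure G (B : Set V) w z * hflux - hgreen
  · intro b hb
    rw [hh, hitProb_of_mem_right G (Finset.mem_coe.2 hb), zero_mul]
  · intro b hb hbw
    rw [harmMeasure_of_ne G (Finset.mem_coe.2 hw) (Finset.mem_coe.2 hb) hbw, zero_mul]

theorem tendsto_harmMeasure (hdeg : ∀ x, 0 < G.degree x) (hconn : G.Connected)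
    (hrec : IsRecurrent G) {a : V → V → ℝ} (ha : IsPotentialKernel G a) {B : Finset V} {x : V}
    (hx : x ∈ B) {w : V} (hw : w ∈ B) (o : V) :
    Tendsto (fun z => harmMeasure G (B : Set V) w z) (comap (fun z => G.dist o z) atTop)
      (𝓝 (laplacian G (hitPotential G a B x) w)) := by
  refine tendsto_of_seq_tendsto fun z hz => ?_
  have hz' : Tendsto (fun n => G.dist o (z n)) atTop atTop :=
    (tendsto_comap (f := fun z => G.dist o z)).comp hz
  have hA := goesToInfinity_singleton hconn hz'
  refine Tendsto.congr' ?_ (tendsto_laplacian G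
    (tendsto_effRes_mul_hitProb G hdeg hconn hrec ha hA hx) w)
  filter_upwards [hA.eventually_forall_notMem B,
    eventually_effRes_ne_zero G hdeg hconn hrec ha hA ⟨x, hx⟩] with n hn hne
  have hzB : z n ∉ B := fun h => hn _ h (Finset.mem_singleton_self _)
  change _ = harmMeasure G (B : Set V) w (z n)
  rw [laplacian_const_mul]
  have h := harmMeasure_eq G hdeg hconn hrec hw hzB
  have hi := inv_effRes G hdeg hn
  rw [Finset.coe_singleton] at hi ⊢
  rw [← h, ← hi]
  field_simp

end Gluing

end GluingTheorem

theorem theorem3p8 {V : Type*} [Countable V] [Infinite V]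
    [MeasurableSpace V] [DiscreteMeasurableSpace V]
    (G : SimpleGraph V) [G.LocallyFinite] (hconn : G.Connected)
    (hrec : GluingTheorem.IsRecurrent G)
    (a : V → V → ℝ) (ha : GluingTheorem.IsPotentialKernel G a)
    (B : Finset V) (hBne : B.Nonempty) (hB : (G.induce (B : Set V)ᶜ).Connected) :
    ∃ q : V → ℝ,
      -- the limit defining `q` exists, along every sequence of sets going to infinity
      (∀ A : ℕ → Finset V, GluingTheorem.GoesToInfinity G A → ∀ w : V,
        Tendsto (fun n => GluingTheorem.effRes G B (A n) *
          (GluingTheorem.walk G w).real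
            {X | GluingTheorem.hitTime (A n : Set V) X < GluingTheorem.hitTime (B : Set V) X})
          atTop (𝓝 (q w))) ∧
      -- `q` in terms of the potential kernel, for every choice of `x ∈ B`
      (∀ x ∈ B, ∀ w : V,
        q w = a w x - ∫ X, a (GluingTheorem.hitPoint (B : Set V) X) x ∂(GluingTheorem.walk G w)) ∧
      (∀ w ∈ B, q w = 0) ∧
      -- the harmonic measure of `B` from infinity exists and is the Laplacian of `q` on `B`
      (∀ w ∈ B, ∀ o : V,
        Tendsto (fun z => (GluingTheorem.walk G z).real
            {X | GluingTheorem.hitTime (B : Set V) X < ⊤ ∧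
              GluingTheorem.hitPoint (B : Set V) X = w})
          (comap (fun z => G.dist o z) atTop) (𝓝 (GluingTheorem.laplacian G q w))) := by
  have hdeg := GluingTheorem.degree_pos G hconn
  obtain ⟨x₀, hx₀⟩ := hBne
  have hlim : ∀ x ∈ B, ∀ A : ℕ → Finset V, GluingTheorem.GoesToInfinity G A → ∀ w,
      Tendsto (fun n => GluingTheorem.effRes G B (A n) *
        GluingTheorem.hitProb G (A n : Set V) (B : Set V) w) atTop
        (𝓝 (GluingTheorem.hitPotential G a B x w)) := fun x hx A hA w =>
    GluingTheorem.tendsto_effRes_mul_hitProb G hdeg hconn hrec ha hA hx w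
  refine ⟨GluingTheorem.hitPotential G a B x₀, hlim x₀ hx₀, fun x hx w => ?_,
    fun w hw => GluingTheorem.hitPotential_of_mem G a x₀ hw, fun w hw o =>
      GluingTheorem.tendsto_harmMeasure G hdeg hconn hrec ha hx₀ hw o⟩
  -- the limit along one fixed sequence does not see the choice of the base point in `B`
  obtain ⟨A, hA⟩ := GluingTheorem.exists_goesToInfinity hconn
  rw [tendsto_nhds_unique (hlim x₀ hx₀ A hA w) (hlim x hx A hA w),
    GluingTheorem.integral_hitPoint G hdeg hconn hrec ⟨x₀, hx₀⟩ (fun v => a v x) w]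
  rfl
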